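/- **Setting.** A player with actions $[K]=\{1,\dots,K\}$ plays rounds $t=1,2,\dots$. In round $t$ the environment chooses a loss vector $\ell_t\in[-1,1]^K$, the player draws an action $I(t)\in[K]$ and incurs $\ell_{t,I(t)}$. Let $\mathcal H_{t-1}$ denote the history before round $t$ (containing the losses, actions and loss estimates of rounds $1,\dots,t-1$). In an *adversarial regime* $\ell_t$ may depend arbitrarily (possibly with randomization) on $\mathcal H_{t-1}$, and the player draws $I(t)$ with $\Pr[I(t)=i\mid\mathcal H_{t-1},\ell_t]=p_{ti}$. The regret is $$R_T=\max_{i^*\in[K]}\mathbb E\Big[\sum_{t=1}^T\ell_{t,I(t)}-\sum_{t=1}^T\ell_{t,i^*}\Big].$$ For $\Delta\in\mathbb R_{\ge0}^K$, $C\ge0$, $T\in\mathbb N$, the environment satisfies a *$(\Delta,C,T)$ self-bounding constraint* if $R_T\ge\mathbb E\big[\sum_{t=1}^T\Delta_{I(t)}\big]-C$. **Algorithm.** Let $\mathcal P(K)$ be the probability simplex, $\alpha\in(0,1)$, $\bar\alpha=1-\alpha$, $\beta_1>0$, $\bar\beta\ge0$, $p_0\in\mathcal P(K)$, and $$\psi(p)=-\frac1\alpha\sum_{i=1}^K(p_i^\alpha-p_i),\qquad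 \bar\psi(p)=-\frac1{\bar\alpha}\sum_{i=1}^K(p_i^{\bar\alpha}-p_i).$$ In each round $t$ the player computes $$q_t\in\operatorname*{arg\,min}_{p\in\mathcal P(K)}\Big\{\sum_{s=1}^{t-1}\langle\hat\ell_s,p\rangle+\beta_t\psi(p)+\bar\beta\bar\psi(p)\Big\},\qquad h_t=-\psi(q_t),$$ chooses $z_t\ge0$ and $\gamma_t\in[0,1/2]$ from the information in $\mathcal H_{t-1}$, draws $I(t)$ from $p_t=(1-\gamma_t)q_t+\gamma_tp_0$, forms an integrable estimate $\hat\ell_t$ of $\ell_t$ that is unbiased, $\mathbb E[\hat\ell_t\mid\mathcal H_{t-1}]=\mathbb E[\ell_t\mid\mathcal H_{t-1}]$, and sets $$\beta_{t+1}=\beta_t+\frac{z_t}{\beta_th_t}.$$ (If $K=1$, so that $h_t=0$, read $\beta_{t+1}=\beta_t$.) Let $D(p,q)=\psi(p)-\psi(q)-\langle\nabla\psi(q),p-q\rangle$, and note that $q_1$ and $h_1$ are deterministic. **Proposition.** For all constants $c_1,c_2>0$ there is a constant $M>0$, depending only on $c_1$ and $c_2$, such that the following holds for every instance of the above. Suppose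 that almost surely $$h_t\le c_1h_{t-1}\quad(t\ge2),\qquad \mathbb E\big[2\gamma_t+\langle\hat\ell_t,q_t-q_{t+1}\rangle-\beta_tD(q_{t+1},q_t)\,\big|\,\mathcal H_{t-1}\big]\le c_2\frac{z_t}{\beta_t}\quad(t\ge1),$$ and that $z_t\le z_{\max}$ for all $t\ge1$, for a constant $z_{\max}>0$. Put $\kappa=\frac{z_{\max}}{\beta_1}+\beta_1h_1+\bar\beta\bar h$ with $\bar h=-\bar\psi(q_1)$, and $\log_+x=\max\{1,\log x\}$ (with $\log_+0=1$). Then for every $T\in\mathbb N$: 1. In every adversarial regime, $$R_T\le M\,\mathbb E\Big[\sqrt{h_1\textstyle\sum_{t=1}^Tz_t}+\kappa\Big]\le M\Big(\sqrt{h_1z_{\max}T}+\kappa\Big).$$ 2. If the environment satisfies a $(\Delta,C,T)$ self-bounding constraint and, for some $\omega(\Delta)>0$, almost surely $h_tz_t\le\omega(\Delta)\langle\Delta,q_t\rangle$ for all $t\ge1$, then $$R_T\le M\left(\omega(\Delta)\log_+\!\Big(\frac{h_1z_{\max}T}{\omega(\Delta)^2+C\omega(\Delta)}\Big)+\sqrt{C\omega(\Delta)\log_+\!\Big(\frac{h_1z_{\max}T}{\omega(\Delta)^2+C\omega(\Delta)}\Big)}+\kappa\right).$$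 -/

import Mathlib

open MeasureTheory

noncomputable section

namespace SPM

/-- The `a`-Tsallis entropy regularizer `ψ(p) = -(1/a) ∑ᵢ (pᵢ ^ a - pᵢ)`. -/
def tsallis {K : ℕ} (a : ℝ) (p : Fin K → ℝ) : ℝ :=
  -(1 / a) * ∑ i, (p i ^ a - p i)

/-- The Bregman divergence `D(p, q) = ψ(p) - ψ(q) - ⟨∇ψ(q), p - q⟩` of a function `ψ`. -/
def bregman {K : ℕ} (ψ : (Fin K → ℝ) → ℝ) (p q : Fin K → ℝ) : ℝ :=
  ψ p - ψ q - fderiv ℝ ψ q (p - q)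

/-- `log₊ x = max {1, log x}`. -/
def logPlus (x : ℝ) : ℝ := max 1 (Real.log x)

/-- The set of minimizers, over the probability simplex, of the hybrid FTRL objective
`p ↦ ⟨L, p⟩ + b ψ(p) + b' ψ'(p)`, where `ψ` is the `a`-Tsallis entropy and `ψ'` is the
`(1 - a)`-Tsallis entropy. -/
def ftrlArgmin {K : ℕ} (a b b' : ℝ) (L : Fin K → ℝ) : Set (Fin K → ℝ) :=
  {q | q ∈ stdSimplex ℝ (Fin K) ∧
    IsMinOn (fun p : Fin K → ℝ => dotProduct L p + b * tsallis a p + b' * tsallis (1 - a) p)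
      (stdSimplex ℝ (Fin K)) q}

/-- The inputs of the algorithm: `α ∈ (0, 1)`, `β₁ > 0`, `βbar ≥ 0` and the exploration basis
`p₀`. -/
structure Params (K : ℕ) where
  α : ℝ
  β₁ : ℝ
  βbar : ℝ
  p₀ : Fin K → ℝ
  α_pos : 0 < α
  α_lt_one : α < 1
  β₁_pos : 0 < β₁
  βbar_nonneg : 0 ≤ βbar
  p₀_mem : p₀ ∈ stdSimplex ℝ (Fin K)

/-- The random quantities appearing in one play of the game. Rounds are numbered `1, 2, 3, …`; the
values at index `0` play no role. -/
structure Play (K : ℕ) (Ω : Type*) where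
  /-- the loss vector chosen by the environment -/
  loss : ℕ → Ω → Fin K → ℝ
  /-- the action chosen by the player -/
  I : ℕ → Ω → Fin K
  /-- the estimate of the loss vector -/
  lossEst : ℕ → Ω → Fin K → ℝ
  /-- the FTRL distribution -/
  q : ℕ → Ω → Fin K → ℝ
  /-- the distribution from which the action is drawn -/
  p : ℕ → Ω → Fin K → ℝ
  /-- the stability quantity -/
  z : ℕ → Ω → ℝ
  /-- the exploration rate -/
  γ : ℕ → Ω → ℝ
  /-- the inverse learning rate -/
  β : ℕ → Ω → ℝ

variable {K : ℕ} {Ω : Type*}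

/-- `h_t = -ψ(q_t)`. -/
def Play.h (X : Play K Ω) (a : ℝ) (t : ℕ) (ω : Ω) : ℝ := -tsallis a (X.q t ω)

/-- The regret against a fixed action `i`,
`R_T(i) = E[∑_{t ≤ T} ℓ_{t, I(t)} - ∑_{t ≤ T} ℓ_{t, i}]`. -/
def Play.regretAgainst [MeasurableSpace Ω] (X : Play K Ω) (μ : Measure Ω) (T : ℕ) (i : Fin K) : ℝ :=
  ∫ ω, (∑ t ∈ Finset.Icc 1 T, X.loss t ω (X.I t ω) - ∑ t ∈ Finset.Icc 1 T, X.loss t ω i) ∂μ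

/-- The regret `R_T = max_i R_T(i)`. -/
def Play.regret [MeasurableSpace Ω] (X : Play K Ω) (μ : Measure Ω) (T : ℕ) : ℝ :=
  ⨆ i : Fin K, X.regretAgainst μ T i

/-- The environment satisfies a `(Δ, C, T)` self-bounding constraint: `Δ ≥ 0`, `C ≥ 0` and
`R_T ≥ E[∑_{t ≤ T} Δ_{I(t)}] - C`. -/
def Play.SelfBounding [MeasurableSpace Ω] (X : Play K Ω) (μ : Measure Ω)
    (Δ : Fin K → ℝ) (C : ℝ) (T : ℕ) : Prop :=
  (∀ i, 0 ≤ Δ i) ∧ 0 ≤ C ∧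
    (∫ ω, ∑ t ∈ Finset.Icc 1 T, Δ (X.I t ω) ∂μ) - C ≤ X.regret μ T

/-- `X` is a play of the game in an adversarial regime in which the player uses FTRL with hybrid
Tsallis regularizers and the stability-penalty-matching learning rate.

`𝓗 t` is the information available after round `t`. It contains at least the losses, the actions
and the loss estimates of the rounds up to `t` (and possibly other observations, such as internal
randomization of the player or of the environment). The loss vector of round `t` may depend in an
arbitrary, possibly randomized, way on `𝓗 (t - 1)`; it does not depend on the draw of the action
of round `t`. -/
structure IsRun {mΩ : MeasurableSpace Ω} (P : Params K) (X : Play K Ω) (μ : Measure Ω)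
    (𝓗 : Filtration ℕ mΩ) : Prop where
  /-- losses lie in `[-1, 1]` -/
  loss_mem : ∀ t, 1 ≤ t → ∀ ω i, X.loss t ω i ∈ Set.Icc (-1 : ℝ) 1
  /-- what happens in round `t` is known after round `t` -/
  loss_meas : ∀ t, 1 ≤ t → Measurable[𝓗 t] (X.loss t)
  I_meas : ∀ t, 1 ≤ t → Measurable[𝓗 t] (X.I t)
  lossEst_meas : ∀ t, 1 ≤ t → Measurable[𝓗 t] (X.lossEst t)
  /-- `q_t`, `z_t` and `γ_t` are computed from the information available before round `t` -/
  q_meas : ∀ t, 1 ≤ t → Measurable[𝓗 (t - 1)] (X.q t)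
  z_meas : ∀ t, 1 ≤ t → Measurable[𝓗 (t - 1)] (X.z t)
  γ_meas : ∀ t, 1 ≤ t → Measurable[𝓗 (t - 1)] (X.γ t)
  /-- the FTRL step -/
  q_mem : ∀ t, 1 ≤ t → ∀ ω,
    X.q t ω ∈ ftrlArgmin P.α (X.β t ω) P.βbar (∑ s ∈ Finset.Ico 1 t, X.lossEst s ω)
  z_nonneg : ∀ t, 1 ≤ t → ∀ ω, 0 ≤ X.z t ω
  γ_mem : ∀ t, 1 ≤ t → ∀ ω, X.γ t ω ∈ Set.Icc (0 : ℝ) (1 / 2)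
  /-- mixing with the exploration basis -/
  p_eq : ∀ t, 1 ≤ t → ∀ ω, X.p t ω = (1 - X.γ t ω) • X.q t ω + X.γ t ω • P.p₀
  /-- given the past and the loss vector of round `t`, the action `I(t)` is drawn from `p_t` -/
  I_law : ∀ t, 1 ≤ t → ∀ i,
    μ[({ω | X.I t ω = i}.indicator fun _ => (1 : ℝ)) |
      𝓗 (t - 1) ⊔ MeasurableSpace.comap (X.loss t) inferInstance] =ᵐ[μ] fun ω => X.p t ω i
  /-- the loss estimate is conditionally unbiased -/
  lossEst_integrable : ∀ t, 1 ≤ t → ∀ i, Integrable (fun ω => X.lossEst t ω i) μ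
  lossEst_unbiased : ∀ t, 1 ≤ t → ∀ i,
    μ[(fun ω => X.lossEst t ω i) | 𝓗 (t - 1)] =ᵐ[μ] μ[(fun ω => X.loss t ω i) | 𝓗 (t - 1)]
  /-- the stability-penalty-matching update `β_{t+1} = β_t + z_t / (β_t h_t)` -/
  β_one : ∀ ω, X.β 1 ω = P.β₁
  β_succ : ∀ t, 1 ≤ t → ∀ ω,
    X.β (t + 1) ω = X.β t ω + X.z t ω / (X.β t ω * X.h P.α t ω)

/-- The stability term of round `t`,
`2 γ_t + ⟨lossEst_t, q_t - q_{t+1}⟩ - β_t D(q_{t+1}, q_t)`. -/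
def Play.stability (X : Play K Ω) (a : ℝ) (t : ℕ) (ω : Ω) : ℝ :=
  2 * X.γ t ω + dotProduct (X.lossEst t ω) (X.q t ω - X.q (t + 1) ω)
    - X.β t ω * bregman (tsallis a) (X.q (t + 1) ω) (X.q t ω)

/-- The condition `h_t = O(h_{t-1})` with constant `c`. -/
def Play.PenaltyCondition [MeasurableSpace Ω] (X : Play K Ω) (μ : Measure Ω) (a c : ℝ) : Prop :=
  ∀ t, 2 ≤ t → ∀ᵐ ω ∂μ, X.h a t ω ≤ c * X.h a (t - 1) ω

/-- The conditional expectation of the stability term of round `t` given the past exists and is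
`O(z_t / β_t)`, with constant `c`. -/
def Play.StabilityCondition {mΩ : MeasurableSpace Ω} (X : Play K Ω) (μ : Measure Ω)
    (𝓗 : Filtration ℕ mΩ) (a c : ℝ) : Prop :=
  ∀ t, 1 ≤ t → Integrable (X.stability a t) μ ∧
    ∀ᵐ ω ∂μ, (μ[X.stability a t | 𝓗 (t - 1)]) ω ≤ c * (X.z t ω / X.β t ω)

/-- `κ = z_max / β₁ + β₁ h₁ + βbar hbar`, where `h₁ = -ψ(q₁)` and `hbar = -ψ'(q₁)`. -/
def kappa (P : Params K) (zmax : ℝ) (q₁ : Fin K → ℝ) : ℝ :=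
  zmax / P.β₁ + P.β₁ * (-tsallis P.α q₁) + P.βbar * (-tsallis (1 - P.α) q₁)

end SPM

end

/-!
The regret is first bounded by `(c₁ + c₂) E[∑ z_t / β_t]` plus the initial values of the
regularizers (`SPM.IsRun.regretAgainst_le`). Unbiasedness turns the expected losses into estimates,
and the usual FTRL telescoping of the minimal objective values leaves, in each round, the stability
term, at most `c₂ z_t / β_t` in conditional expectation, and the penalty term
`(β_{t+1} - β_t) h_{t+1} ≤ c₁ (β_{t+1} - β_t) h_t`. The update rule says exactly that
`(β_{t+1} - β_t) h_t = z_t / β_t`. The minimizers are interior points of the simplex, so that the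
Bregman divergence and the division by `h_t` are genuine as soon as there are two actions.

It remains to bound `∑ z_t / β_t` along a path (`SPM.sum_div_le`). Rounds in which `β` more than
doubles contribute at most `2 z_max / β₁`, by a geometric series. For the others, two thresholds
`θ₁ ≤ θ₂` are fixed. As long as `β_t ≤ θ₁`, the identity `z_t / β_t = h_t (β_{t+1} - β_t)` and
`h_t ≤ h₁` give a total of `2 h₁ θ₁`; the bound `h_t ≤ h₁` holds because the uniform distribution
minimizes both regularizers. Once `β_t > θ₂`, the sum is at most `(∑ z_t) / θ₂`. In between,
`(z_t / β_t)² = h_t z_t · (β_{t+1} - β_t) / β_t`, and the sum of the last factors is of order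
`log (θ₂ / θ₁)`, so that the geometric-arithmetic mean inequality with a weight `η` applies.

Taking `θ₁ = θ₂ = √(∑ z_t / h₁)` gives the adversarial bound. Under the self-bounding constraint
`E[∑ h_t z_t]` is at most `2 w (R_T + C)`, and the choice `h₁ θ₁ = √(w² + C w)`,
`θ₂ / θ₁ = max {1, h₁ z_max T / (w² + C w)}` and a suitable deterministic `η`
(`SPM.self_bounding_tuning`) absorb half of the regret and leave the logarithmic bound.
-/

open MeasureTheory

noncomputable section
namespace SPM

/-! ### Tsallis entropy on the simplex -/

lemma tsallis_nonpos {K : ℕ} {a : ℝ} (ha0 : 0 < a) (ha1 : a < 1) {p : Fin K → ℝ}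
    (hp : p ∈ stdSimplex ℝ (Fin K)) : tsallis a p ≤ 0 := by
  have h : 0 ≤ ∑ i, (p i ^ a - p i) := Finset.sum_nonneg fun i _ => by
    have h1 := mem_Icc_of_mem_stdSimplex hp i
    have := Real.rpow_le_rpow_of_exponent_ge' h1.1 h1.2 ha0.le ha1.le
    rw [Real.rpow_one] at this
    linarith
  have h2 : 0 ≤ 1 / a * ∑ i, (p i ^ a - p i) := by positivity
  unfold tsallis
  linarith

lemma tsallis_single {K : ℕ} {a : ℝ} (ha0 : a ≠ 0) (i : Fin K) :
    tsallis a (Pi.single i 1) = 0 := by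
  unfold tsallis
  rw [Finset.sum_eq_zero, mul_zero]
  intro j _
  by_cases h : j = i
  · subst h; simp
  · simp [h, Real.zero_rpow ha0]

/-- The Tsallis entropy is strictly negative in the relative interior of a simplex with at least
two vertices; this makes the learning-rate update there a genuine division. -/
lemma tsallis_neg {K : ℕ} (hK : 2 ≤ K) {a : ℝ} (ha0 : 0 < a) (ha1 : a < 1) {p : Fin K → ℝ}
    (hp : p ∈ stdSimplex ℝ (Fin K)) (hpos : ∀ i, 0 < p i) : tsallis a p < 0 := by
  have h : 0 < ∑ i, (p i ^ a - p i) := by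
    refine Finset.sum_pos (fun i _ => ?_) ⟨⟨0, by omega⟩, Finset.mem_univ _⟩
    have hlt : p i < 1 := by
      obtain ⟨j, hj⟩ : ∃ j : Fin K, j ≠ i := by
        have : Nontrivial (Fin K) := Fin.nontrivial_iff_two_le.2 hK
        exact exists_ne i
      have := Finset.add_le_sum (s := Finset.univ) (f := p) (fun k _ => (hpos k).le)
        (Finset.mem_univ i) (Finset.mem_univ j) hj.symm
      rw [hp.2] at this
      linarith [hpos j]
    have := Real.rpow_lt_rpow_of_exponent_gt (hpos i) hlt ha1
    rw [Real.rpow_one] at this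
    linarith
  have h2 : 0 < 1 / a * ∑ i, (p i ^ a - p i) := by positivity
  unfold tsallis
  linarith

/-- Convexity of the Tsallis entropy along a segment, with the surplus that a coordinate
vanishing at one end gives: there the power grows like `ε ^ a` instead of linearly. -/
lemma tsallis_segment_le {K : ℕ} {a : ℝ} (ha0 : 0 < a) (ha1 : a < 1) {p q : Fin K → ℝ}
    (hp : ∀ i, 0 ≤ p i) (hq : ∀ i, 0 ≤ q i) {ε : ℝ} (hε0 : 0 ≤ ε) (hε1 : ε ≤ 1)
    (S : Finset (Fin K)) (hS : ∀ i ∈ S, q i = 0) :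
    tsallis a ((1 - ε) • q + ε • p) ≤ (1 - ε) * tsallis a q + ε * tsallis a p
      - 1 / a * ∑ i ∈ S, (ε ^ a - ε) * p i ^ a := by
  have key : (1 - ε) * ∑ i, (q i ^ a - q i) + ε * ∑ i, (p i ^ a - p i)
      + ∑ i ∈ S, (ε ^ a - ε) * p i ^ a
      ≤ ∑ i, (((1 - ε) • q + ε • p) i ^ a - ((1 - ε) • q + ε • p) i) := by
    rw [← Finset.sum_filter_add_sum_filter_not Finset.univ (· ∈ S)
        (fun i => (((1 - ε) • q + ε • p) i ^ a - ((1 - ε) • q + ε • p) i)),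
      ← Finset.sum_filter_add_sum_filter_not Finset.univ (· ∈ S) (fun i => q i ^ a - q i),
      ← Finset.sum_filter_add_sum_filter_not Finset.univ (· ∈ S) (fun i => p i ^ a - p i)]
    simp only [Finset.filter_univ_mem]
    have h1 : ∑ i ∈ S, ((1 - ε) * (q i ^ a - q i) + ε * (p i ^ a - p i) + (ε ^ a - ε) * p i ^ a)
        ≤ ∑ i ∈ S, (((1 - ε) • q + ε • p) i ^ a - ((1 - ε) • q + ε • p) i) :=
      Finset.sum_le_sum fun i hi => by
        simp only [Pi.add_apply, Pi.smul_apply, smul_eq_mul, hS i hi, mul_zero, zero_add,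
          Real.zero_rpow ha0.ne', Real.mul_rpow hε0 (hp i)]
        linarith
    have h2 : ∑ i with i ∉ S, ((1 - ε) * (q i ^ a - q i) + ε * (p i ^ a - p i))
        ≤ ∑ i with i ∉ S, (((1 - ε) • q + ε • p) i ^ a - ((1 - ε) • q + ε • p) i) :=
      Finset.sum_le_sum fun i _ => by
        have := (Real.concaveOn_rpow ha0.le ha1.le).2 (hq i) (hp i) (sub_nonneg.2 hε1) hε0
          (by ring)
        simp only [Pi.add_apply, Pi.smul_apply, smul_eq_mul] at this ⊢
        linarith
    simp only [Finset.sum_add_distrib, ← Finset.mul_sum] at h1 h2 ⊢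
    linarith
  have := mul_le_mul_of_nonneg_left key (one_div_nonneg.2 ha0.le)
  unfold tsallis
  linarith

/-- By Jensen's inequality, the uniform distribution minimizes the Tsallis entropy. -/
lemma tsallis_uniform_le {K : ℕ} {a : ℝ} (ha0 : 0 < a) (ha1 : a < 1) {p : Fin K → ℝ}
    (hp : p ∈ stdSimplex ℝ (Fin K)) : tsallis a (fun _ : Fin K => (K : ℝ)⁻¹) ≤ tsallis a p := by
  rcases Nat.eq_zero_or_pos K with rfl | hK
  · simp [tsallis]
  have hK' : (0 : ℝ) < K := by exact_mod_cast hK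
  have h := (Real.concaveOn_rpow ha0.le ha1.le).le_map_sum (t := Finset.univ)
    (w := fun _ : Fin K => (K : ℝ)⁻¹) (p := p) (fun _ _ => by positivity)
    (by simp [hK'.ne']) (fun i _ => hp.1 i)
  simp only [smul_eq_mul, ← Finset.mul_sum, hp.2, mul_one] at h
  rw [inv_mul_le_iff₀ hK'] at h
  have : ∑ i, (p i ^ a - p i) ≤ ∑ _i : Fin K, ((K : ℝ)⁻¹ ^ a - (K : ℝ)⁻¹) := by
    rw [Finset.sum_sub_distrib, hp.2]
    simp only [Finset.sum_const, Finset.card_univ, Fintype.card_fin, nsmul_eq_mul, mul_sub,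
      mul_inv_cancel₀ hK'.ne']
    linarith
  have := mul_le_mul_of_nonneg_left this (one_div_nonneg.2 ha0.le)
  unfold tsallis
  linarith

lemma uniform_mem_stdSimplex {K : ℕ} (hK : 0 < K) :
    (fun _ : Fin K => (K : ℝ)⁻¹) ∈ stdSimplex ℝ (Fin K) := by
  have hK' : (0 : ℝ) < K := by exact_mod_cast hK
  exact ⟨fun _ => by positivity, by simp [hK'.ne']⟩

lemma pos_of_mem_stdSimplex {K : ℕ} {p : Fin K → ℝ} (hp : p ∈ stdSimplex ℝ (Fin K)) : 0 < K := by
  rcases Nat.eq_zero_or_pos K with rfl | hK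
  · simpa using hp.2
  · exact hK

/-! ### Minimizers of the hybrid FTRL objective -/

/-- The objective minimized by the FTRL step. -/
def ftrlObj {K : ℕ} (a b b' : ℝ) (L p : Fin K → ℝ) : ℝ :=
  dotProduct L p + b * tsallis a p + b' * tsallis (1 - a) p

lemma ftrlObj_le {K : ℕ} {a b b' : ℝ} {L q p : Fin K → ℝ} (hq : q ∈ ftrlArgmin a b b' L)
    (hp : p ∈ stdSimplex ℝ (Fin K)) : ftrlObj a b b' L q ≤ ftrlObj a b b' L p :=
  hq.2 hp

/-- A minimizer for the zero loss has maximal entropy: the uniform distribution minimizes both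
regularizers simultaneously. -/
lemma tsallis_le_of_mem_ftrlArgmin_zero {K : ℕ} {a b b' : ℝ} (ha0 : 0 < a) (ha1 : a < 1)
    (hb : 0 < b) (hb' : 0 ≤ b') {q p : Fin K → ℝ} (hq : q ∈ ftrlArgmin a b b' 0)
    (hp : p ∈ stdSimplex ℝ (Fin K)) : tsallis a q ≤ tsallis a p := by
  refine le_trans ?_ (tsallis_uniform_le ha0 ha1 hp)
  have h := ftrlObj_le hq (uniform_mem_stdSimplex (pos_of_mem_stdSimplex hp))
  have h' := mul_le_mul_of_nonneg_left
    (tsallis_uniform_le (a := 1 - a) (by linarith) (by linarith) hq.1) hb'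
  simp only [ftrlObj, zero_dotProduct] at h
  exact le_of_mul_le_mul_left (by linarith) hb

/-- Minimizers lie in the relative interior, because the slope of `-x ^ a` at `0` is `-∞`. -/
lemma pos_of_mem_ftrlArgmin {K : ℕ} {a b b' : ℝ} (ha0 : 0 < a) (ha1 : a < 1)
    (hb : 0 < b) (hb' : 0 ≤ b') {L q : Fin K → ℝ} (hq : q ∈ ftrlArgmin a b b' L) (i : Fin K) :
    0 < q i := by
  by_contra hi
  have hi0 : q i = 0 := le_antisymm (not_lt.1 hi) (hq.1.1 i)
  have hK := pos_of_mem_stdSimplex hq.1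
  have hK' : (0 : ℝ) < K := by exact_mod_cast hK
  set u : Fin K → ℝ := fun _ => (K : ℝ)⁻¹ with hu
  have hum : u ∈ stdSimplex ℝ (Fin K) := uniform_mem_stdSimplex hK
  set A : ℝ := b * (1 / a) * (K : ℝ)⁻¹ ^ a with hA
  have hA0 : 0 < A := by positivity
  -- Moving a little towards the uniform distribution may not decrease the objective.
  have key : ∀ ε : ℝ, 0 < ε → ε < 1 →
      A * (ε ^ (a - 1) - 1) ≤ ftrlObj a b b' L u - ftrlObj a b b' L q := by
    intro ε h0 h1
    have hm : (1 - ε) • q + ε • u ∈ stdSimplex ℝ (Fin K) :=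
      (convex_stdSimplex ℝ (Fin K)) hq.1 hum (by linarith) h0.le (by ring)
    have e1 := ftrlObj_le hq hm
    have e2 := mul_le_mul_of_nonneg_left (tsallis_segment_le ha0 ha1 hum.1 hq.1.1 h0.le h1.le {i}
      (by simpa using hi0)) hb.le
    have e3 := mul_le_mul_of_nonneg_left (tsallis_segment_le (a := 1 - a) (by linarith)
      (by linarith) hum.1 hq.1.1 h0.le h1.le ∅ (by simp)) hb'
    simp only [Finset.sum_singleton, Finset.sum_empty, mul_zero, sub_zero] at e2 e3
    have e4 : ε ^ a = ε * ε ^ (a - 1) := by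
      rw [Real.rpow_sub_one h0.ne']; field_simp
    have e5 : b * (1 / a * ((ε ^ a - ε) * u i ^ a)) = ε * (A * (ε ^ (a - 1) - 1)) := by
      rw [e4, hA]; ring
    refine le_of_mul_le_mul_left ?_ h0
    simp only [ftrlObj, dotProduct_add, dotProduct_smul, smul_eq_mul] at e1 ⊢
    linarith
  have hlim : Filter.Tendsto (fun ε : ℝ => A * (ε ^ (a - 1) - 1)) (nhdsWithin 0 (Set.Ioi 0))
      Filter.atTop :=
    (Filter.tendsto_atTop_add_const_right _ (-1)
      (tendsto_rpow_neg_nhdsGT_zero (by linarith))).const_mul_atTop hA0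
  have h1 := hlim.eventually_gt_atTop (ftrlObj a b b' L u - ftrlObj a b b' L q)
  have h2 : ∀ᶠ ε : ℝ in nhdsWithin 0 (Set.Ioi 0), 0 < ε ∧ ε < 1 :=
    Ioo_mem_nhdsGT one_pos
  obtain ⟨ε, h3, h4, h5⟩ := (h1.and h2).exists
  exact absurd (key ε h4 h5) (not_le.2 h3)

lemma differentiableAt_tsallis {K : ℕ} (a : ℝ) {q : Fin K → ℝ} (hq : ∀ i, 0 < q i) :
    DifferentiableAt ℝ (tsallis a) q := by
  unfold tsallis
  refine DifferentiableAt.const_mul (DifferentiableAt.fun_sum fun i _ => ?_) _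
  have h : DifferentiableAt ℝ (fun p : Fin K → ℝ => p i) q := differentiableAt_apply i q
  exact (h.rpow_const (Or.inl (hq i).ne')).sub h

/-- First-order optimality: leaving a minimizer costs at least the Bregman divergence of the main
regularizer. -/
lemma mul_bregman_le_ftrlObj_sub {K : ℕ} {a b b' : ℝ} (ha0 : 0 < a) (ha1 : a < 1)
    (hb : 0 < b) (hb' : 0 ≤ b') {L q r : Fin K → ℝ} (hq : q ∈ ftrlArgmin a b b' L)
    (hr : r ∈ stdSimplex ℝ (Fin K)) :
    b * bregman (tsallis a) r q ≤ ftrlObj a b b' L r - ftrlObj a b b' L q := by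
  have hd := (differentiableAt_tsallis a (pos_of_mem_ftrlArgmin ha0 ha1 hb hb' hq)).hasFDerivAt
  have hlim := (hd.hasLineDerivAt (r - q)).tendsto_slope_zero_right
  -- Only the main regularizer is differentiated; the other one enters through convexity.
  have key : 0 ≤ dotProduct L (r - q) + b * fderiv ℝ (tsallis a) q (r - q)
      + b' * (tsallis (1 - a) r - tsallis (1 - a) q) := by
    refine ge_of_tendsto ((((hlim.const_mul b).const_add (dotProduct L (r - q))).add_const
      (b' * (tsallis (1 - a) r - tsallis (1 - a) q)))) ?_
    filter_upwards [Ioo_mem_nhdsGT (one_pos (α := ℝ))] with ε hε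
    have hseg : q + ε • (r - q) = (1 - ε) • q + ε • r := by
      ext i; simp; ring
    have hm : (1 - ε) • q + ε • r ∈ stdSimplex ℝ (Fin K) :=
      (convex_stdSimplex ℝ (Fin K)) hq.1 hr (by linarith [hε.2]) hε.1.le (by ring)
    have e1 := ftrlObj_le hq hm
    have e3 := mul_le_mul_of_nonneg_left (tsallis_segment_le (a := 1 - a) (by linarith)
      (by linarith) hr.1 hq.1.1 hε.1.le hε.2.le ∅ (by simp)) hb'
    simp only [Finset.sum_empty, mul_zero, sub_zero] at e3
    simp only [hseg, smul_eq_mul]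
    have hε0 := hε.1
    have e4 : 0 ≤ ε * (dotProduct L (r - q) + b * (ε⁻¹ *
        (tsallis a ((1 - ε) • q + ε • r) - tsallis a q))
        + b' * (tsallis (1 - a) r - tsallis (1 - a) q)) := by
      have : ε * (dotProduct L (r - q) + b * (ε⁻¹ *
          (tsallis a ((1 - ε) • q + ε • r) - tsallis a q))
          + b' * (tsallis (1 - a) r - tsallis (1 - a) q)) = ε * dotProduct L (r - q) + b *
          (tsallis a ((1 - ε) • q + ε • r) - tsallis a q)
          + ε * (b' * (tsallis (1 - a) r - tsallis (1 - a) q)) := by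
        field_simp
      rw [this]
      simp only [ftrlObj, dotProduct_add, dotProduct_sub, dotProduct_smul, smul_eq_mul] at e1 ⊢
      linarith
    exact nonneg_of_mul_nonneg_right e4 hε0
  simp only [ftrlObj, bregman, dotProduct_sub] at key ⊢
  linarith

/-! ### The learning-rate recursion along one path -/

/-- The per-round potential inequality. Here `b` and `b'` are consecutive inverse learning rates,
so `x / b = h * (b' - b)`. Rounds in which the rate more than doubles are charged to the decrease
of `1 / b`; the others are split according to `b ≤ θ₁`, `θ₁ < b ≤ θ₂` and `θ₂ < b`. -/
lemma div_le_potential {b b' h x H zmax θ₁ θ₂ η : ℝ} (hb : 0 < b) (hh : 0 < h) (hhH : h ≤ H)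
    (hx : 0 ≤ x) (hxz : x ≤ zmax) (hb' : b' = b + x / (b * h)) (hθ : 0 < θ₁) (hθ' : θ₁ ≤ θ₂)
    (hη : 0 < η) :
    x / b ≤ 2 * zmax * (1 / b - 1 / b') + H * (min b' (2 * θ₁) - min b (2 * θ₁)) + x / θ₂
      + η / 2 * (h * x)
      + 1 / η * (Real.log (max (min b' (2 * θ₂)) θ₁) - Real.log (max (min b (2 * θ₂)) θ₁)) := by
  have hbb : b ≤ b' := by rw [hb']; linarith [show 0 ≤ x / (b * h) by positivity]
  have hb0' : 0 < b' := hb.trans_le hbb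
  have hθ2 : 0 < θ₂ := hθ.trans_le hθ'
  have hz : 0 ≤ zmax := hx.trans hxz
  have hxb : x / b = h * (b' - b) := by rw [hb']; field_simp; ring
  have t1 : 0 ≤ 2 * zmax * (1 / b - 1 / b') := by
    have := one_div_le_one_div_of_le hb hbb
    have : 0 ≤ 1 / b - 1 / b' := by linarith
    positivity
  have t2 : 0 ≤ H * (min b' (2 * θ₁) - min b (2 * θ₁)) :=
    mul_nonneg (hh.le.trans hhH) (sub_nonneg.2 (min_le_min_right _ hbb))
  have t3 : 0 ≤ x / θ₂ := by positivity
  have t4 : 0 ≤ η / 2 * (h * x) := by positivity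
  have t5 : 0 ≤ 1 / η *
      (Real.log (max (min b' (2 * θ₂)) θ₁) - Real.log (max (min b (2 * θ₂)) θ₁)) :=
    mul_nonneg (by positivity) (sub_nonneg.2 (Real.log_le_log (lt_max_of_lt_right hθ)
      (max_le_max_right _ (min_le_min_right _ hbb))))
  rcases lt_or_ge (2 * b) b' with hj | hj
  · have h1 : 1 / b' ≤ 1 / (2 * b) := one_div_le_one_div_of_le (by positivity) hj.le
    have h2 : 1 / (2 * b) = 1 / b / 2 := by field_simp
    have h3 : zmax * (1 / b) ≤ 2 * zmax * (1 / b - 1 / b') := by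
      rw [h2] at h1
      nlinarith
    have h4 : x / b ≤ zmax * (1 / b) := by
      rw [mul_one_div]; gcongr
    linarith
  rcases le_or_gt b θ₁ with h1 | h1
  · have : h * (b' - b) ≤ H * (min b' (2 * θ₁) - min b (2 * θ₁)) := by
      rw [min_eq_left (by linarith), min_eq_left (by linarith)]
      exact mul_le_mul_of_nonneg_right hhH (by linarith)
    linarith
  rcases lt_or_ge θ₂ b with h2 | h2
  · have : x / b ≤ x / θ₂ := div_le_div_of_nonneg_left hx hθ2 h2.le
    linarith
  · have e1 : max (min b' (2 * θ₂)) θ₁ = b' := by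
      rw [min_eq_left (by linarith), max_eq_left (by linarith)]
    have e2 : max (min b (2 * θ₂)) θ₁ = b := by
      rw [min_eq_left (by linarith), max_eq_left (by linarith)]
    rw [e1, e2] at t5 ⊢
    set y := (b' - b) / b with hy
    have hy0 : 0 ≤ y := div_nonneg (by linarith) hb.le
    have hlog : y / 2 ≤ Real.log b' - Real.log b := by
      rw [← Real.log_div hb0'.ne' hb.ne']
      refine le_trans ?_ (Real.one_sub_inv_le_log_of_pos (by positivity))
      rw [inv_div, one_sub_div hb0'.ne', hy, div_div]
      exact div_le_div_of_nonneg_left (by linarith) hb0' (by linarith)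
    -- `(x / b) ^ 2 = (h * x) * y`, so the geometric-arithmetic mean inequality applies.
    have hprod : (x / b) ^ 2 = (h * x) * y := by
      have : x = h * (b' - b) * b := by rw [← hxb]; field_simp
      rw [hxb, hy]
      rw [this]; field_simp
    have ham : x / b ≤ η / 2 * (h * x) + 1 / η * (y / 2) := by
      refine abs_le_of_sq_le_sq' ?_ (by positivity) |>.2
      have : η / 2 * (h * x) * (1 / η * (y / 2)) = (h * x) * y / 4 := by field_simp; ring
      nlinarith [sq_nonneg (η / 2 * (h * x) - 1 / η * (y / 2))]
    have : 1 / η * (y / 2) ≤ 1 / η * (Real.log b' - Real.log b) :=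
      mul_le_mul_of_nonneg_left hlog (by positivity)
    linarith

lemma initial_le_of_rec {b h z : ℕ → ℝ} (hb1 : 0 < b 1) (hh : ∀ t, 1 ≤ t → 0 ≤ h t)
    (hz : ∀ t, 1 ≤ t → 0 ≤ z t) (hb : ∀ t, 1 ≤ t → b (t + 1) = b t + z t / (b t * h t)) :
    ∀ t, 1 ≤ t → b 1 ≤ b t := by
  intro t ht
  induction t, ht using Nat.le_induction with
  | base => exact le_rfl
  | succ t ht ih =>
    rw [hb t ht]
    have := hh t ht
    have := hz t ht
    have : 0 < b t := hb1.trans_le ih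
    linarith [show 0 ≤ z t / (b t * h t) by positivity]

/-- The penalty and stability sum of a stability-penalty-matching sequence, in terms of free
thresholds `θ₁ ≤ θ₂` for the inverse learning rate and a free weight `η`. -/
lemma sum_div_le {b h z : ℕ → ℝ} {H zmax θ₁ θ₂ η : ℝ} (T : ℕ) (hb1 : 0 < b 1)
    (hh : ∀ t, 1 ≤ t → 0 < h t) (hhH : ∀ t, 1 ≤ t → h t ≤ H)
    (hz : ∀ t, 1 ≤ t → 0 ≤ z t) (hzm : ∀ t, 1 ≤ t → z t ≤ zmax)
    (hb : ∀ t, 1 ≤ t → b (t + 1) = b t + z t / (b t * h t))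
    (hθ : 0 < θ₁) (hθ' : θ₁ ≤ θ₂) (hη : 0 < η) :
    ∑ t ∈ Finset.Icc 1 T, z t / b t ≤ 2 * (zmax / b 1) + 2 * (H * θ₁)
      + (∑ t ∈ Finset.Icc 1 T, z t) / θ₂ + η / 2 * ∑ t ∈ Finset.Icc 1 T, h t * z t
      + 1 / η * Real.log (2 * θ₂ / θ₁) := by
  have hbt := initial_le_of_rec hb1 (fun t ht => (hh t ht).le) hz hb
  have hH : 0 ≤ H := (hh 1 le_rfl).le.trans (hhH 1 le_rfl)
  have hzm0 : 0 ≤ zmax := (hz 1 le_rfl).trans (hzm 1 le_rfl)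
  have hT : 0 < b (T + 1) := hb1.trans_le (hbt _ (by omega))
  have tel : ∀ f : ℝ → ℝ, ∑ t ∈ Finset.Icc 1 T, (f (b (t + 1)) - f (b t))
      = f (b (T + 1)) - f (b 1) := fun f => by
    rw [← Finset.Ico_add_one_right_eq_Icc,
      Finset.sum_Ico_sub (fun t => f (b t)) (by omega)]
  have key := Finset.sum_le_sum fun t (ht : t ∈ Finset.Icc 1 T) =>
    have ht := (Finset.mem_Icc.1 ht).1
    div_le_potential (hb1.trans_le (hbt t ht)) (hh t ht) (hhH t ht) (hz t ht) (hzm t ht)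
      (hb t ht) hθ hθ' hη
  simp only [Finset.sum_add_distrib, ← Finset.mul_sum, ← Finset.sum_div] at key
  have s1 := tel fun x => -(1 / x)
  have s2 := tel fun x => min x (2 * θ₁)
  have s3 := tel fun x => Real.log (max (min x (2 * θ₂)) θ₁)
  simp only [neg_sub_neg] at s1
  rw [s1, s2, s3] at key
  have r1 : 2 * zmax * (1 / b 1 - 1 / b (T + 1)) ≤ 2 * (zmax / b 1) := by
    have : 0 ≤ zmax * (1 / b (T + 1)) := by positivity
    have e : zmax / b 1 = zmax * (1 / b 1) := by rw [mul_one_div]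
    rw [e]; linarith
  have r2 : H * (min (b (T + 1)) (2 * θ₁) - min (b 1) (2 * θ₁)) ≤ 2 * (H * θ₁) := by
    have h1 : min (b (T + 1)) (2 * θ₁) ≤ 2 * θ₁ := min_le_right _ _
    have h2 : 0 ≤ min (b 1) (2 * θ₁) := le_min hb1.le (by linarith)
    nlinarith
  have r3 : Real.log (max (min (b (T + 1)) (2 * θ₂)) θ₁)
      - Real.log (max (min (b 1) (2 * θ₂)) θ₁) ≤ Real.log (2 * θ₂ / θ₁) := by
    rw [Real.log_div (by linarith) hθ.ne']
    refine sub_le_sub (Real.log_le_log (lt_max_of_lt_right hθ) ?_)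
      (Real.log_le_log hθ (le_max_right _ _))
    exact max_le (min_le_right _ _) (by linarith)
  have r3' := mul_le_mul_of_nonneg_left r3 (one_div_nonneg.2 hη.le)
  linarith

/-- The worst-case form: both thresholds at `√(∑ z / H)`. -/
lemma sum_div_le_sqrt {b h z : ℕ → ℝ} {H zmax : ℝ} (T : ℕ) (hb1 : 0 < b 1)
    (hh : ∀ t, 1 ≤ t → 0 < h t) (hhH : ∀ t, 1 ≤ t → h t ≤ H)
    (hz : ∀ t, 1 ≤ t → 0 ≤ z t) (hzm : ∀ t, 1 ≤ t → z t ≤ zmax)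
    (hb : ∀ t, 1 ≤ t → b (t + 1) = b t + z t / (b t * h t)) :
    ∑ t ∈ Finset.Icc 1 T, z t / b t
      ≤ 5 * √(H * ∑ t ∈ Finset.Icc 1 T, z t) + 2 * (zmax / b 1) := by
  have hH : 0 < H := (hh 1 le_rfl).trans_le (hhH 1 le_rfl)
  have hzm0 : 0 ≤ zmax := (hz 1 le_rfl).trans (hzm 1 le_rfl)
  have hz' : ∀ t ∈ Finset.Icc 1 T, 0 ≤ z t := fun t ht => hz t (Finset.mem_Icc.1 ht).1
  set Z := ∑ t ∈ Finset.Icc 1 T, z t with hZ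
  rcases (Finset.sum_nonneg hz').eq_or_lt with h0 | h0
  · have := (Finset.sum_eq_zero_iff_of_nonneg hz').1 h0.symm
    rw [Finset.sum_eq_zero (fun t ht => by rw [this t ht, zero_div])]
    positivity
  rw [← hZ] at h0
  set s := √(H * Z) with hs
  have hs0 : 0 < s := Real.sqrt_pos.2 (by positivity)
  have hss : s * s = H * Z := Real.mul_self_sqrt (by positivity)
  have key := sum_div_le (θ₁ := s / H) (θ₂ := s / H) (η := 1 / s) T hb1 hh hhH hz hzm hb
    (by positivity) le_rfl (by positivity)
  have e1 : H * (s / H) = s := by field_simp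
  have e2 : Z / (s / H) = s := by
    rw [div_div_eq_mul_div, div_eq_iff hs0.ne', hss]; ring
  have e3 : 1 / s / 2 * ∑ t ∈ Finset.Icc 1 T, h t * z t ≤ s / 2 := by
    have : ∑ t ∈ Finset.Icc 1 T, h t * z t ≤ s * s := by
      rw [hss, hZ, Finset.mul_sum]
      exact Finset.sum_le_sum fun t ht =>
        mul_le_mul_of_nonneg_right (hhH t (Finset.mem_Icc.1 ht).1) (hz' t ht)
    calc _ ≤ 1 / s / 2 * (s * s) := by gcongr
      _ = s / 2 := by field_simp
  have e4 : 1 / (1 / s) * Real.log (2 * (s / H) / (s / H)) ≤ s := by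
    rw [mul_div_assoc, div_self (by positivity), one_div_one_div, mul_one]
    nlinarith [Real.log_two_lt_d9]
  rw [e1, ← hZ, e2] at key
  linarith

/-- Tuning of the free parameters in `sum_div_le` against a self-bounding constraint: `R` is the
regret, `2 * w * (R + C)` bounds the expected sum of `h * z`, `A` bounds the sum of `z`, and the
two parts of `κ` are `κ₀ = zmax / β₁` and the initial values `κ₁` of the regularizers. -/
lemma self_bounding_tuning {c H A w C R κ₀ κ₁ : ℝ} (hc : 0 < c) (hH : 0 < H)
    (hw : 0 < w) (hC : 0 ≤ C) (hκ₀ : 0 ≤ κ₀) (hκ₁ : 0 ≤ κ₁)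
    (hR : ∀ θ₁ θ₂ η : ℝ, 0 < θ₁ → θ₁ ≤ θ₂ → 0 < η →
      R ≤ c * (2 * κ₀ + 2 * (H * θ₁) + A / θ₂ + η / 2 * (2 * w * (R + C))
        + 1 / η * Real.log (2 * θ₂ / θ₁)) + κ₁) :
    R ≤ (12 * c + 8 * c ^ 2 + 2) * (w * logPlus (H * A / (w ^ 2 + C * w)) +
      √(C * w * logPlus (H * A / (w ^ 2 + C * w))) + (κ₀ + κ₁)) := by
  set B := w ^ 2 + C * w with hB
  have hB0 : 0 < B := by positivity
  set L := logPlus (H * A / B) with hL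
  have hL1 : 1 ≤ L := le_max_left _ _
  have hLlog : Real.log (H * A / B) ≤ L := le_max_right _ _
  set s := √B with hs
  have hs0 : 0 < s := Real.sqrt_pos.2 hB0
  have hss : s * s = B := Real.mul_self_sqrt hB0.le
  set r := √(C * w * L) with hr
  have hr0 : 0 ≤ r := Real.sqrt_nonneg _
  have hrr : r * r = C * w * L := Real.mul_self_sqrt (by positivity)
  have hwL : w ≤ w * L := le_mul_of_one_le_right hw.le hL1
  have hs_le : s ≤ w * L + r := by
    refine Real.sqrt_le_iff.2 ⟨by positivity, ?_⟩
    have h1 : w ^ 2 ≤ (w * L) ^ 2 := pow_le_pow_left₀ hw.le hwL 2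
    have h2 : C * w ≤ C * w * L := le_mul_of_one_le_right (by positivity) hL1
    have h3 : 0 ≤ w * L * r := by positivity
    nlinarith
  rcases lt_or_ge R 0 with hneg | hR0
  · refine hneg.le.trans ?_
    positivity
  -- `ν = 1 / η`: the first summand absorbs half of the regret, the second balances the `C` terms.
  set ν := 2 * c * w + r / L with hν
  have hν0 : 0 < ν := by positivity
  have hmain := hR (s / H) (max (s / H) (A / s)) (1 / ν) (by positivity) (le_max_left _ _)
    (by positivity)
  have e1 : H * (s / H) = s := by field_simp
  have e2 : A / max (s / H) (A / s) ≤ s := by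
    rw [div_le_iff₀ (lt_max_of_lt_left (by positivity))]
    calc A = s * (A / s) := by field_simp
      _ ≤ s * max (s / H) (A / s) := mul_le_mul_of_nonneg_left (le_max_right _ _) hs0.le
  have e3 : Real.log (2 * max (s / H) (A / s) / (s / H)) ≤ 2 * L := by
    have hl2 := Real.log_two_lt_d9
    rcases le_total (A / s) (s / H) with h | h
    · rw [max_eq_left h, mul_div_assoc, div_self (by positivity), mul_one]
      linarith
    · have hA0 : 0 < A := by
        have : 0 < A / s := lt_of_lt_of_le (by positivity) h
        exact (div_pos_iff_of_pos_right hs0).1 this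
      have : 2 * max (s / H) (A / s) / (s / H) = 2 * (H * A / B) := by
        rw [max_eq_right h, ← hss]; field_simp
      rw [this, Real.log_mul two_ne_zero (by positivity)]
      linarith
  have e4 : c * (1 / ν / 2 * (2 * w * (R + C))) ≤ R / 2 + c * r := by
    have h1 : c * w * (R + C) ≤ (R / 2 + c * r) * ν := by
      have : C * w ≤ r * ν := by
        have : r * (r / L) = C * w := by
          rw [← mul_div_assoc, hrr]; field_simp
        rw [hν, mul_add, this]
        have : 0 ≤ r * (2 * c * w) := by positivity
        linarith
      have h2 : c * (C * w) ≤ c * (r * ν) := mul_le_mul_of_nonneg_left this hc.le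
      have h3 : 0 ≤ R / 2 * (r / L) := by positivity
      have h4 : R / 2 * ν = c * w * R + R / 2 * (r / L) := by rw [hν]; ring
      linarith
    calc c * (1 / ν / 2 * (2 * w * (R + C))) = c * w * (R + C) / ν := by field_simp
      _ ≤ _ := (div_le_iff₀ hν0).2 h1
  have e5 : 1 / (1 / ν) * Real.log (2 * max (s / H) (A / s) / (s / H))
      ≤ 4 * c * (w * L) + 2 * r := by
    rw [one_div_one_div]
    calc _ ≤ ν * (2 * L) := mul_le_mul_of_nonneg_left e3 hν0.le
      _ = 4 * c * (w * L) + 2 * r := by rw [hν]; field_simp; ring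
  rw [e1] at hmain
  have e2' := mul_le_mul_of_nonneg_left e2 hc.le
  have e5' := mul_le_mul_of_nonneg_left e5 hc.le
  have es := mul_le_mul_of_nonneg_left hs_le hc.le
  have p1 : 0 ≤ c * (w * L) := by positivity
  have p2 : 0 ≤ c ^ 2 * r := by positivity
  have p3 : 0 ≤ c * κ₀ := by positivity
  have p4 : 0 ≤ c * κ₁ := by positivity
  have p5 : 0 ≤ c ^ 2 * κ₀ := by positivity
  have p6 : 0 ≤ c ^ 2 * κ₁ := by positivity
  have p7 : 0 ≤ w * L := by positivity
  linarith

/-! ### Conditional expectations of the played actions and of the loss estimates -/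

lemma integral_mul_eq_of_condExp {Ω : Type*} {m mΩ : MeasurableSpace Ω} {μ : Measure Ω}
    [IsProbabilityMeasure μ] (hm : m ≤ mΩ) {f g g' : Ω → ℝ} {c : ℝ} (hf : Measurable[m] f)
    (hfc : ∀ ω, |f ω| ≤ c) (hg : Integrable g μ) (hgg' : μ[g | m] =ᵐ[μ] g') :
    ∫ ω, f ω * g ω ∂μ = ∫ ω, f ω * g' ω ∂μ := by
  have hfg : Integrable (f * g) μ :=
    hg.bdd_mul (c := c) (hf.mono hm le_rfl).aestronglyMeasurable
      (Filter.Eventually.of_forall hfc)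
  have h := condExp_mul_of_stronglyMeasurable_left hf.stronglyMeasurable hfg hg
  calc ∫ ω, f ω * g ω ∂μ = ∫ ω, (μ[f * g | m]) ω ∂μ := (integral_condExp hm).symm
    _ = ∫ ω, f ω * g' ω ∂μ := integral_congr_ae <| by
      filter_upwards [h, hgg'] with ω h1 h2
      rw [h1, Pi.mul_apply, h2]

variable {K : ℕ} {Ω : Type*} {mΩ : MeasurableSpace Ω} {μ : Measure Ω} {𝓗 : Filtration ℕ mΩ}
  {P : Params K} {X : Play K Ω}

lemma integrable_of_bound [IsProbabilityMeasure μ] {f : Ω → ℝ} {c : ℝ} (hf : Measurable f)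
    (hc : ∀ᵐ ω ∂μ, |f ω| ≤ c) : Integrable f μ :=
  Integrable.of_bound hf.aestronglyMeasurable c hc

lemma integrable_mul_of_past [IsProbabilityMeasure μ] {t : ℕ}
    {f g : Ω → ℝ} (hf : Measurable[𝓗 (t - 1)] f) (hfc : ∀ ω, |f ω| ≤ 1) (hg : Integrable g μ) :
    Integrable (fun ω => f ω * g ω) μ :=
  hg.bdd_mul (c := 1) (hf.mono (𝓗.le _) le_rfl).aestronglyMeasurable
    (Filter.Eventually.of_forall hfc)

namespace IsRun

lemma q_mem_stdSimplex (hX : IsRun P X μ 𝓗) {t : ℕ} (ht : 1 ≤ t) (ω : Ω) :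
    X.q t ω ∈ stdSimplex ℝ (Fin K) :=
  (hX.q_mem t ht ω).1

lemma abs_q_le (hX : IsRun P X μ 𝓗) {t : ℕ} (ht : 1 ≤ t) (ω : Ω) (i : Fin K) :
    |X.q t ω i| ≤ 1 := by
  have := mem_Icc_of_mem_stdSimplex (hX.q_mem_stdSimplex ht ω) i
  exact abs_le.2 ⟨by linarith [this.1], this.2⟩

lemma p_mem_stdSimplex (hX : IsRun P X μ 𝓗) {t : ℕ} (ht : 1 ≤ t) (ω : Ω) :
    X.p t ω ∈ stdSimplex ℝ (Fin K) := by
  rw [hX.p_eq t ht ω]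
  have := hX.γ_mem t ht ω
  exact (convex_stdSimplex ℝ (Fin K)) (hX.q_mem_stdSimplex ht ω) P.p₀_mem (by linarith [this.2])
    this.1 (by ring)

lemma abs_loss_le (hX : IsRun P X μ 𝓗) {t : ℕ} (ht : 1 ≤ t) (ω : Ω) (i : Fin K) :
    |X.loss t ω i| ≤ 1 :=
  abs_le.2 (hX.loss_mem t ht ω i)

lemma h_nonneg (hX : IsRun P X μ 𝓗) {t : ℕ} (ht : 1 ≤ t) (ω : Ω) : 0 ≤ X.h P.α t ω :=
  neg_nonneg.2 (tsallis_nonpos P.α_pos P.α_lt_one (hX.q_mem_stdSimplex ht ω))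

lemma le_β (hX : IsRun P X μ 𝓗) {t : ℕ} (ht : 1 ≤ t) (ω : Ω) : P.β₁ ≤ X.β t ω := by
  have := initial_le_of_rec (b := fun t => X.β t ω) (h := fun t => X.h P.α t ω)
    (z := fun t => X.z t ω) (by simpa only [hX.β_one ω] using P.β₁_pos)
    (fun t ht => hX.h_nonneg ht ω) (fun t ht => hX.z_nonneg t ht ω)
    (fun t ht => hX.β_succ t ht ω) t ht
  simpa only [hX.β_one ω] using this

lemma β_pos (hX : IsRun P X μ 𝓗) {t : ℕ} (ht : 1 ≤ t) (ω : Ω) : 0 < X.β t ω :=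
  P.β₁_pos.trans_le (hX.le_β ht ω)

lemma h_pos (hX : IsRun P X μ 𝓗) (hK : 2 ≤ K) {t : ℕ} (ht : 1 ≤ t) (ω : Ω) :
    0 < X.h P.α t ω :=
  neg_pos.2 (tsallis_neg hK P.α_pos P.α_lt_one (hX.q_mem_stdSimplex ht ω)
    (pos_of_mem_ftrlArgmin P.α_pos P.α_lt_one (hX.β_pos ht ω) P.βbar_nonneg (hX.q_mem t ht ω)))

lemma h_le (hX : IsRun P X μ 𝓗) {q₁ : Fin K → ℝ} (hq₁ : q₁ ∈ ftrlArgmin P.α P.β₁ P.βbar 0)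
    {t : ℕ} (ht : 1 ≤ t) (ω : Ω) : X.h P.α t ω ≤ -tsallis P.α q₁ :=
  neg_le_neg (tsallis_le_of_mem_ftrlArgmin_zero P.α_pos P.α_lt_one P.β₁_pos P.βbar_nonneg hq₁
    (hX.q_mem_stdSimplex ht ω))

lemma measurable_z (hX : IsRun P X μ 𝓗) {t : ℕ} (ht : 1 ≤ t) : Measurable (X.z t) :=
  (hX.z_meas t ht).mono (𝓗.le _) le_rfl

lemma measurable_h (hX : IsRun P X μ 𝓗) {t : ℕ} (ht : 1 ≤ t) : Measurable (X.h P.α t) := by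
  have hq : Measurable (X.q t) := (hX.q_meas t ht).mono (𝓗.le _) le_rfl
  have h : ∀ i, Measurable fun ω => X.q t ω i := fun i => (measurable_pi_apply i).comp hq
  unfold Play.h tsallis
  fun_prop

lemma measurable_β (hX : IsRun P X μ 𝓗) {t : ℕ} (ht : 1 ≤ t) : Measurable (X.β t) := by
  induction t, ht using Nat.le_induction with
  | base => exact (funext hX.β_one : X.β 1 = fun _ => P.β₁) ▸ measurable_const
  | succ t ht ih =>
    have := hX.measurable_z ht
    have := hX.measurable_h ht
    rw [show X.β (t + 1) = fun ω => X.β t ω + X.z t ω / (X.β t ω * X.h P.α t ω) from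
      funext (hX.β_succ t ht)]
    fun_prop

/-- The action of round `t` may be averaged out against any quantity known once the past and the
loss vector of that round are. -/
lemma integral_apply_I [IsProbabilityMeasure μ] (hX : IsRun P X μ 𝓗) {t : ℕ} (ht : 1 ≤ t)
    {f : Ω → Fin K → ℝ} {c : ℝ} (hfc : ∀ ω i, |f ω i| ≤ c)
    (hf : ∀ i, Measurable[𝓗 (t - 1) ⊔ MeasurableSpace.comap (X.loss t) inferInstance]
      fun ω => f ω i) :
    Integrable (fun ω => f ω (X.I t ω)) μ ∧
      Integrable (fun ω => dotProduct (f ω) (X.p t ω)) μ ∧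
      ∫ ω, f ω (X.I t ω) ∂μ = ∫ ω, dotProduct (f ω) (X.p t ω) ∂μ := by
  have hm : 𝓗 (t - 1) ⊔ MeasurableSpace.comap (X.loss t) inferInstance ≤ mΩ :=
    sup_le (𝓗.le _) (((hX.loss_meas t ht).mono (𝓗.le _) le_rfl).comap_le)
  have hI : Measurable (X.I t) := (hX.I_meas t ht).mono (𝓗.le _) le_rfl
  have hf' : ∀ i, Measurable fun ω => f ω i := fun i => (hf i).mono hm le_rfl
  have hind : ∀ i, Measurable ({ω | X.I t ω = i}.indicator fun _ => (1 : ℝ)) := fun i =>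
    measurable_const.indicator (hI (measurableSet_singleton i))
  have hindb : ∀ i ω, |({ω | X.I t ω = i}.indicator (fun _ => (1 : ℝ)) ω)| ≤ 1 := by
    intro i ω
    by_cases h : X.I t ω = i <;> simp [Set.indicator, h]
  have hindi : ∀ i, Integrable ({ω | X.I t ω = i}.indicator fun _ => (1 : ℝ)) μ := fun i =>
    integrable_of_bound (hind i) (Filter.Eventually.of_forall (hindb i))
  have hq : ∀ i, Measurable fun ω => X.q t ω i := fun i =>
    (measurable_pi_apply i).comp ((hX.q_meas t ht).mono (𝓗.le _) le_rfl)
  have hγ : Measurable (X.γ t) := (hX.γ_meas t ht).mono (𝓗.le _) le_rfl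
  have hp : ∀ i, Measurable fun ω => X.p t ω i := fun i => by
    rw [show (fun ω => X.p t ω i) = fun ω => (1 - X.γ t ω) * X.q t ω i + X.γ t ω * P.p₀ i from
      funext fun ω => by rw [hX.p_eq t ht ω]; rfl]
    have := hq i
    fun_prop
  have hpi : ∀ i, Integrable (fun ω => X.p t ω i) μ := fun i =>
    integrable_of_bound (c := 1) (hp i) (Filter.Eventually.of_forall fun ω => by
      have := mem_Icc_of_mem_stdSimplex (hX.p_mem_stdSimplex ht ω) i
      exact abs_le.2 ⟨by linarith [this.1], this.2⟩)
  have hsum : (fun ω => f ω (X.I t ω)) =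
      fun ω => ∑ i, f ω i * {ω | X.I t ω = i}.indicator (fun _ => (1 : ℝ)) ω := by
    funext ω
    rw [Finset.sum_eq_single (X.I t ω)]
    · simp
    · intro j _ hj
      simp [hj.symm]
    · simp
  have hint : ∀ i, Integrable
      (fun ω => f ω i * {ω | X.I t ω = i}.indicator (fun _ => (1 : ℝ)) ω) μ := fun i =>
    (hindi i).bdd_mul (c := c) (hf' i).aestronglyMeasurable
      (Filter.Eventually.of_forall fun ω => hfc ω i)
  have hfp : ∀ i, Integrable (fun ω => f ω i * X.p t ω i) μ := fun i =>
    (hpi i).bdd_mul (c := c) (hf' i).aestronglyMeasurable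
      (Filter.Eventually.of_forall fun ω => hfc ω i)
  rw [hsum]
  refine ⟨integrable_finsetSum _ fun i _ => hint i, integrable_finsetSum _ fun i _ => hfp i, ?_⟩
  rw [integral_finsetSum _ fun i _ => hint i]
  simp only [dotProduct]
  rw [integral_finsetSum _ fun i _ => hfp i]
  exact Finset.sum_congr rfl fun i _ => integral_mul_eq_of_condExp hm (hf i)
    (fun ω => hfc ω i) (hindi i) (hX.I_law t ht i)

lemma integrable_loss [IsProbabilityMeasure μ] (hX : IsRun P X μ 𝓗) {t : ℕ} (ht : 1 ≤ t)
    (i : Fin K) : Integrable (fun ω => X.loss t ω i) μ :=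
  integrable_of_bound ((measurable_pi_apply i).comp ((hX.loss_meas t ht).mono (𝓗.le _) le_rfl))
    (Filter.Eventually.of_forall fun ω => hX.abs_loss_le ht ω i)

/-- Unbiasedness, tested against a bounded quantity known before the round. -/
lemma integral_mul_lossEst [IsProbabilityMeasure μ] (hX : IsRun P X μ 𝓗) {t : ℕ} (ht : 1 ≤ t)
    {f : Ω → ℝ} (hf : Measurable[𝓗 (t - 1)] f) (hfc : ∀ ω, |f ω| ≤ 1) (i : Fin K) :
    ∫ ω, f ω * X.loss t ω i ∂μ = ∫ ω, f ω * X.lossEst t ω i ∂μ := by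
  rw [integral_mul_eq_of_condExp (𝓗.le _) hf hfc (hX.integrable_loss ht i) Filter.EventuallyEq.rfl,
    integral_mul_eq_of_condExp (𝓗.le _) hf hfc (hX.lossEst_integrable t ht i)
      (hX.lossEst_unbiased t ht i)]

lemma integrable_γ [IsProbabilityMeasure μ] (hX : IsRun P X μ 𝓗) {t : ℕ} (ht : 1 ≤ t) :
    Integrable (X.γ t) μ :=
  integrable_of_bound (c := 1) ((hX.γ_meas t ht).mono (𝓗.le _) le_rfl)
    (Filter.Eventually.of_forall fun ω => by
      have := hX.γ_mem t ht ω
      exact abs_le.2 ⟨by linarith [this.1], by linarith [this.2]⟩)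

/-- Exploration changes the expected loss by at most `2 γ`. -/
lemma dotProduct_p_le (hX : IsRun P X μ 𝓗) {t : ℕ} (ht : 1 ≤ t) (ω : Ω) :
    dotProduct (X.loss t ω) (X.p t ω) ≤
      dotProduct (X.loss t ω) (X.q t ω) + 2 * X.γ t ω := by
  have habs : ∀ r ∈ stdSimplex ℝ (Fin K), |dotProduct (X.loss t ω) r| ≤ 1 := by
    intro r hr
    refine (Finset.abs_sum_le_sum_abs _ _).trans ?_
    rw [← hr.2]
    refine Finset.sum_le_sum fun i _ => ?_
    rw [abs_mul, abs_of_nonneg (hr.1 i)]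
    exact mul_le_of_le_one_left (hr.1 i) (hX.abs_loss_le ht ω i)
  have h1 := abs_le.1 (habs _ (hX.q_mem_stdSimplex ht ω))
  have h2 := abs_le.1 (habs _ P.p₀_mem)
  have hγ := (hX.γ_mem t ht ω).1
  rw [hX.p_eq t ht ω, dotProduct_add, dotProduct_smul, dotProduct_smul, smul_eq_mul, smul_eq_mul]
  nlinarith [h1.1, h1.2, h2.1, h2.2]

/-- One round of regret, in terms of the loss estimates. -/
lemma integral_loss_sub_le [IsProbabilityMeasure μ] (hX : IsRun P X μ 𝓗) {t : ℕ} (ht : 1 ≤ t)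
    (i : Fin K) :
    Integrable (fun ω => dotProduct (X.lossEst t ω) (X.q t ω) - X.lossEst t ω i
        + 2 * X.γ t ω) μ ∧
      Integrable (fun ω => X.loss t ω (X.I t ω) - X.loss t ω i) μ ∧
      ∫ ω, (X.loss t ω (X.I t ω) - X.loss t ω i) ∂μ ≤
        ∫ ω, (dotProduct (X.lossEst t ω) (X.q t ω) - X.lossEst t ω i + 2 * X.γ t ω) ∂μ := by
  have hq : ∀ j, Measurable[𝓗 (t - 1)] fun ω => X.q t ω j := fun j =>
    (measurable_pi_apply j).comp (hX.q_meas t ht)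
  have hqb : ∀ j ω, |X.q t ω j| ≤ 1 := fun j ω => hX.abs_q_le ht ω j
  have hloss : ∀ j, Measurable[𝓗 (t - 1) ⊔ MeasurableSpace.comap (X.loss t) inferInstance]
      fun ω => X.loss t ω j := fun j =>
    (measurable_pi_apply j).comp ((comap_measurable (X.loss t)).mono le_sup_right le_rfl)
  obtain ⟨hI, hIp, hIe⟩ := hX.integral_apply_I ht (fun ω j => hX.abs_loss_le ht ω j) hloss
  have il := fun j => hX.integrable_loss ht j
  have ile := fun j => hX.lossEst_integrable t ht j
  have iγ := (hX.integrable_γ ht).const_mul 2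
  have iql : ∀ j, Integrable (fun ω => X.q t ω j * X.loss t ω j) μ := fun j =>
    integrable_mul_of_past (hq j) (hqb j) (il j)
  have iqe : ∀ j, Integrable (fun ω => X.q t ω j * X.lossEst t ω j) μ := fun j =>
    integrable_mul_of_past (hq j) (hqb j) (ile j)
  have idl : Integrable (fun ω => dotProduct (X.loss t ω) (X.q t ω)) μ := by
    simp only [dotProduct_comm (X.loss t _)]
    exact integrable_finsetSum _ fun j _ => iql j
  have ide : Integrable (fun ω => dotProduct (X.lossEst t ω) (X.q t ω)) μ := by
    simp only [dotProduct_comm (X.lossEst t _)]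
    exact integrable_finsetSum _ fun j _ => iqe j
  have e1 : ∫ ω, dotProduct (X.loss t ω) (X.q t ω) ∂μ
      = ∫ ω, dotProduct (X.lossEst t ω) (X.q t ω) ∂μ := by
    simp only [dotProduct_comm (X.loss t _), dotProduct_comm (X.lossEst t _)]
    simp only [dotProduct]
    rw [integral_finsetSum _ fun j _ => iql j, integral_finsetSum _ fun j _ => iqe j]
    exact Finset.sum_congr rfl fun j _ => hX.integral_mul_lossEst ht (hq j) (hqb j) j
  have e2 : ∫ ω, X.loss t ω i ∂μ = ∫ ω, X.lossEst t ω i ∂μ := by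
    simpa using hX.integral_mul_lossEst ht (f := fun _ => 1) measurable_const (by simp) i
  have is : Integrable (fun ω => dotProduct (X.lossEst t ω) (X.q t ω) - X.lossEst t ω i) μ :=
    ide.sub (ile i)
  refine ⟨is.add iγ, hI.sub (il i), ?_⟩
  rw [integral_sub hI (il i), hIe, integral_add is iγ, integral_sub ide (ile i), ← e1, ← e2]
  have e3 := integral_mono hIp (idl.add iγ) (fun ω => hX.dotProduct_p_le ht ω)
  simp only [Pi.add_apply] at e3
  rw [integral_add idl iγ] at e3
  linarith

end IsRun

/-! ### The regret bound for FTRL with a varying learning rate -/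

namespace IsRun

/-- The FTRL inequality along one path, in telescoped form. -/
lemma sum_dotProduct_le (hX : IsRun P X μ 𝓗) (ω : Ω) (T : ℕ) :
    ∑ t ∈ Finset.Icc 1 T, (dotProduct (X.lossEst t ω) (X.q t ω) + 2 * X.γ t ω) ≤
      ∑ t ∈ Finset.Icc 1 T, (X.stability P.α t ω
        + (X.β (t + 1) ω - X.β t ω) * X.h P.α (t + 1) ω)
      + ftrlObj P.α (X.β (T + 1) ω) P.βbar (∑ s ∈ Finset.Icc 1 T, X.lossEst s ω) (X.q (T + 1) ω)
      - ftrlObj P.α P.β₁ P.βbar 0 (X.q 1 ω) := by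
  induction T with
  | zero => simp [hX.β_one ω]
  | succ T ih =>
    have hT : 1 ≤ T + 1 := by omega
    have hq := hX.q_mem (T + 1) hT ω
    rw [Finset.Ico_add_one_right_eq_Icc] at hq
    have h := mul_bregman_le_ftrlObj_sub P.α_pos P.α_lt_one (hX.β_pos hT ω) P.βbar_nonneg
      hq (hX.q_mem_stdSimplex (t := T + 1 + 1) (by omega) ω)
    rw [Finset.sum_Icc_succ_top hT, Finset.sum_Icc_succ_top hT, Finset.sum_Icc_succ_top hT]
    simp only [ftrlObj, Play.stability, Play.h, add_dotProduct, dotProduct_sub] at ih h ⊢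
    linarith

/-- Comparison with a vertex of the simplex, where both regularizers vanish. -/
lemma sum_dotProduct_sub_le (hX : IsRun P X μ 𝓗) {q₁ : Fin K → ℝ}
    (hq₁ : q₁ ∈ ftrlArgmin P.α P.β₁ P.βbar 0) (ω : Ω) (T : ℕ) (i : Fin K) :
    ∑ t ∈ Finset.Icc 1 T, (dotProduct (X.lossEst t ω) (X.q t ω) - X.lossEst t ω i
        + 2 * X.γ t ω) ≤
      ∑ t ∈ Finset.Icc 1 T, (X.stability P.α t ω
        + (X.β (t + 1) ω - X.β t ω) * X.h P.α (t + 1) ω)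
      + (P.β₁ * (-tsallis P.α q₁) + P.βbar * (-tsallis (1 - P.α) q₁)) := by
  have h := hX.sum_dotProduct_le ω T
  have hq := hX.q_mem (T + 1) (by omega) ω
  rw [Finset.Ico_add_one_right_eq_Icc] at hq
  have h1 := ftrlObj_le hq (single_mem_stdSimplex ℝ i)
  have h2 := ftrlObj_le hq₁ (hX.q_mem_stdSimplex le_rfl ω)
  have hα := P.α_lt_one
  simp only [ftrlObj, dotProduct_single, mul_one, tsallis_single P.α_pos.ne',
    tsallis_single (sub_pos.2 hα).ne', mul_zero, add_zero, Finset.sum_apply, zero_dotProduct]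
    at h h1 h2
  have e : ∑ t ∈ Finset.Icc 1 T, (dotProduct (X.lossEst t ω) (X.q t ω) - X.lossEst t ω i
        + 2 * X.γ t ω) = ∑ t ∈ Finset.Icc 1 T,
        (dotProduct (X.lossEst t ω) (X.q t ω) + 2 * X.γ t ω)
      - ∑ t ∈ Finset.Icc 1 T, X.lossEst t ω i := by
    rw [← Finset.sum_sub_distrib]
    exact Finset.sum_congr rfl fun t _ => by ring
  rw [e]
  linarith

lemma integrable_z_div_β [IsProbabilityMeasure μ] (hX : IsRun P X μ 𝓗) {zmax : ℝ}
    (hz : ∀ᵐ ω ∂μ, ∀ t, 1 ≤ t → X.z t ω ≤ zmax) {t : ℕ} (ht : 1 ≤ t) :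
    Integrable (fun ω => X.z t ω / X.β t ω) μ := by
  refine integrable_of_bound (c := zmax / P.β₁) ((hX.measurable_z ht).div (hX.measurable_β ht)) ?_
  filter_upwards [hz] with ω h
  rw [abs_of_nonneg (div_nonneg (hX.z_nonneg t ht ω) (hX.β_pos ht ω).le)]
  exact div_le_div₀ ((hX.z_nonneg t ht ω).trans (h t ht)) (h t ht) P.β₁_pos (hX.le_β ht ω)

lemma integrable_z [IsProbabilityMeasure μ] (hX : IsRun P X μ 𝓗) {zmax : ℝ}
    (hz : ∀ᵐ ω ∂μ, ∀ t, 1 ≤ t → X.z t ω ≤ zmax) {t : ℕ} (ht : 1 ≤ t) :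
    Integrable (X.z t) μ := by
  refine integrable_of_bound (c := zmax) (hX.measurable_z ht) ?_
  filter_upwards [hz] with ω h
  rw [abs_of_nonneg (hX.z_nonneg t ht ω)]
  exact h t ht

/-- The regret is at most a constant times the expected sum of `z / β`, up to the initial values
of the regularizers: the update rule makes the stability term `z / β` and the penalty term
`(β' - β) h` of a round equal. -/
lemma regretAgainst_le [IsProbabilityMeasure μ] (hX : IsRun P X μ 𝓗) (hK : 2 ≤ K)
    {c₁ c₂ : ℝ} (hpen : X.PenaltyCondition μ P.α c₁)
    (hst : X.StabilityCondition μ 𝓗 P.α c₂) {zmax : ℝ}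
    (hz : ∀ᵐ ω ∂μ, ∀ t, 1 ≤ t → X.z t ω ≤ zmax) {q₁ : Fin K → ℝ}
    (hq₁ : q₁ ∈ ftrlArgmin P.α P.β₁ P.βbar 0) (T : ℕ) (i : Fin K) :
    X.regretAgainst μ T i ≤ (c₁ + c₂) * ∫ ω, ∑ t ∈ Finset.Icc 1 T, X.z t ω / X.β t ω ∂μ
      + (P.β₁ * (-tsallis P.α q₁) + P.βbar * (-tsallis (1 - P.α) q₁)) := by
  set k := P.β₁ * (-tsallis P.α q₁) + P.βbar * (-tsallis (1 - P.α) q₁) with hk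
  have mem : ∀ {t}, t ∈ Finset.Icc 1 T → 1 ≤ t := fun h => (Finset.mem_Icc.1 h).1
  have izb := fun t ht => hX.integrable_z_div_β hz (t := t) ht
  have iS : Integrable (fun ω => ∑ t ∈ Finset.Icc 1 T, X.stability P.α t ω) μ :=
    integrable_finsetSum _ fun t ht => (hst t (mem ht)).1
  have iZ : Integrable (fun ω => ∑ t ∈ Finset.Icc 1 T, X.z t ω / X.β t ω) μ :=
    integrable_finsetSum _ fun t ht => izb t (mem ht)
  have h1 : X.regretAgainst μ T i ≤ ∫ ω, ∑ t ∈ Finset.Icc 1 T,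
      (dotProduct (X.lossEst t ω) (X.q t ω) - X.lossEst t ω i + 2 * X.γ t ω) ∂μ := by
    unfold Play.regretAgainst
    simp only [← Finset.sum_sub_distrib]
    rw [integral_finsetSum _ fun t ht => (hX.integral_loss_sub_le (mem ht) i).2.1,
      integral_finsetSum _ fun t ht => (hX.integral_loss_sub_le (mem ht) i).1]
    exact Finset.sum_le_sum fun t ht => (hX.integral_loss_sub_le (mem ht) i).2.2
  have h2 : ∫ ω, ∑ t ∈ Finset.Icc 1 T,
      (dotProduct (X.lossEst t ω) (X.q t ω) - X.lossEst t ω i + 2 * X.γ t ω) ∂μ ≤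
      ∫ ω, (∑ t ∈ Finset.Icc 1 T, X.stability P.α t ω
        + c₁ * ∑ t ∈ Finset.Icc 1 T, X.z t ω / X.β t ω + k) ∂μ := by
    refine integral_mono_ae
      (integrable_finsetSum _ fun t ht => (hX.integral_loss_sub_le (mem ht) i).1)
      ((iS.add (iZ.const_mul c₁)).add (integrable_const k)) ?_
    have hpen' : ∀ᵐ ω ∂μ, ∀ t, 2 ≤ t → X.h P.α t ω ≤ c₁ * X.h P.α (t - 1) ω := by
      rw [ae_all_iff]; intro t
      by_cases ht : 2 ≤ t
      · filter_upwards [hpen t ht] with ω h _ using h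
      · exact Filter.Eventually.of_forall fun ω h => absurd h ht
    filter_upwards [hpen'] with ω hω
    refine (hX.sum_dotProduct_sub_le hq₁ ω T i).trans ?_
    rw [Finset.mul_sum, ← Finset.sum_add_distrib]
    refine add_le_add_left (Finset.sum_le_sum fun t ht => ?_) k
    have ht := mem ht
    have hp := hω (t + 1) (by omega)
    rw [Nat.add_sub_cancel] at hp
    have hβ := hX.β_pos ht ω
    have hh := hX.h_pos hK ht ω
    have hd : 0 ≤ X.β (t + 1) ω - X.β t ω := by
      rw [hX.β_succ t ht ω]
      have := hX.z_nonneg t ht ω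
      rw [add_sub_cancel_left]; positivity
    have he : (X.β (t + 1) ω - X.β t ω) * X.h P.α t ω = X.z t ω / X.β t ω := by
      rw [hX.β_succ t ht ω]; field_simp; ring
    have := mul_le_mul_of_nonneg_left hp hd
    rw [← he]
    linarith
  have h3 : ∫ ω, ∑ t ∈ Finset.Icc 1 T, X.stability P.α t ω ∂μ ≤
      c₂ * ∫ ω, ∑ t ∈ Finset.Icc 1 T, X.z t ω / X.β t ω ∂μ := by
    rw [integral_finsetSum _ fun t ht => (hst t (mem ht)).1,
      integral_finsetSum _ fun t ht => izb t (mem ht), Finset.mul_sum]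
    refine Finset.sum_le_sum fun t ht => ?_
    rw [← integral_condExp (𝓗.le (t - 1)), ← integral_const_mul]
    exact integral_mono_ae integrable_condExp ((izb t (mem ht)).const_mul c₂) (hst t (mem ht)).2
  have i1 : Integrable (fun ω => c₁ * ∑ t ∈ Finset.Icc 1 T, X.z t ω / X.β t ω) μ :=
    iZ.const_mul c₁
  have i2 : Integrable (fun ω => ∑ t ∈ Finset.Icc 1 T, X.stability P.α t ω
      + c₁ * ∑ t ∈ Finset.Icc 1 T, X.z t ω / X.β t ω) μ := iS.add i1
  rw [integral_add i2 (integrable_const k), integral_add iS i1, integral_const_mul,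
    integral_const, probReal_univ, one_smul] at h2
  linarith

/-! ### The self-bounding constraint -/

/-- Since at most half of the probability is spent on exploration, the gap of the FTRL
distribution is at most twice the expected gap of the action. -/
lemma integral_dotProduct_q_le [IsProbabilityMeasure μ] (hX : IsRun P X μ 𝓗) {Δ : Fin K → ℝ}
    (hΔ : ∀ i, 0 ≤ Δ i) {t : ℕ} (ht : 1 ≤ t) :
    Integrable (fun ω => dotProduct Δ (X.q t ω)) μ ∧ Integrable (fun ω => Δ (X.I t ω)) μ ∧
      ∫ ω, dotProduct Δ (X.q t ω) ∂μ ≤ 2 * ∫ ω, Δ (X.I t ω) ∂μ := by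
  obtain ⟨hI, hIp, hIe⟩ := hX.integral_apply_I ht (f := fun _ => Δ) (c := ∑ j, Δ j)
    (fun _ i => by
      rw [abs_of_nonneg (hΔ i)]
      exact Finset.single_le_sum (fun j _ => hΔ j) (Finset.mem_univ i))
    (fun i => measurable_const)
  have hq : ∀ j, Measurable fun ω => X.q t ω j := fun j =>
    (measurable_pi_apply j).comp ((hX.q_meas t ht).mono (𝓗.le _) le_rfl)
  have iq : Integrable (fun ω => dotProduct Δ (X.q t ω)) μ :=
    integrable_finsetSum _ fun j _ => (integrable_of_bound (c := 1) (hq j)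
      (Filter.Eventually.of_forall fun ω => hX.abs_q_le ht ω j)).const_mul (Δ j)
  refine ⟨iq, hI, ?_⟩
  rw [hIe, ← integral_const_mul]
  refine integral_mono iq (hIp.const_mul 2) fun ω => ?_
  have hγ := hX.γ_mem t ht ω
  have h0 : 0 ≤ dotProduct Δ (X.q t ω) :=
    Finset.sum_nonneg fun j _ => mul_nonneg (hΔ j) ((hX.q_mem_stdSimplex ht ω).1 j)
  have h1 : 0 ≤ dotProduct Δ P.p₀ :=
    Finset.sum_nonneg fun j _ => mul_nonneg (hΔ j) (P.p₀_mem.1 j)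
  simp only [hX.p_eq t ht ω, dotProduct_add, dotProduct_smul, smul_eq_mul]
  nlinarith [hγ.1, hγ.2]

lemma integrable_h_mul_z [IsProbabilityMeasure μ] (hX : IsRun P X μ 𝓗) {zmax : ℝ}
    (hz : ∀ᵐ ω ∂μ, ∀ t, 1 ≤ t → X.z t ω ≤ zmax) {q₁ : Fin K → ℝ}
    (hq₁ : q₁ ∈ ftrlArgmin P.α P.β₁ P.βbar 0) {t : ℕ} (ht : 1 ≤ t) :
    Integrable (fun ω => X.h P.α t ω * X.z t ω) μ :=
  (hX.integrable_z hz ht).bdd_mul (c := -tsallis P.α q₁) (hX.measurable_h ht).aestronglyMeasurable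
    (Filter.Eventually.of_forall fun ω => by
      rw [Real.norm_of_nonneg (hX.h_nonneg ht ω)]
      exact hX.h_le hq₁ ht ω)

lemma integral_sum_h_mul_z_le [IsProbabilityMeasure μ] (hX : IsRun P X μ 𝓗) {zmax : ℝ}
    (hz : ∀ᵐ ω ∂μ, ∀ t, 1 ≤ t → X.z t ω ≤ zmax) {q₁ : Fin K → ℝ}
    (hq₁ : q₁ ∈ ftrlArgmin P.α P.β₁ P.βbar 0) {T : ℕ} {Δ : Fin K → ℝ} {C w : ℝ}
    (hsb : X.SelfBounding μ Δ C T) (hw : 0 < w)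
    (hhz : ∀ t, 1 ≤ t → ∀ᵐ ω ∂μ, X.h P.α t ω * X.z t ω ≤ w * dotProduct Δ (X.q t ω)) :
    ∫ ω, ∑ t ∈ Finset.Icc 1 T, X.h P.α t ω * X.z t ω ∂μ ≤ 2 * w * (X.regret μ T + C) := by
  obtain ⟨hΔ, -, hR⟩ := hsb
  have mem : ∀ {t}, t ∈ Finset.Icc 1 T → 1 ≤ t := fun h => (Finset.mem_Icc.1 h).1
  rw [integral_finsetSum _ fun t ht => (hX.integral_dotProduct_q_le hΔ (mem ht)).2.1] at hR
  rw [integral_finsetSum _ fun t ht => hX.integrable_h_mul_z hz hq₁ (mem ht)]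
  calc ∑ t ∈ Finset.Icc 1 T, ∫ ω, X.h P.α t ω * X.z t ω ∂μ
      ≤ ∑ t ∈ Finset.Icc 1 T, 2 * w * ∫ ω, Δ (X.I t ω) ∂μ := Finset.sum_le_sum fun t ht => by
        obtain ⟨h1, -, h3⟩ := hX.integral_dotProduct_q_le hΔ (mem ht)
        have := integral_mono_ae (hX.integrable_h_mul_z hz hq₁ (mem ht)) (h1.const_mul w)
          (hhz t (mem ht))
        rw [integral_const_mul] at this
        nlinarith
    _ = 2 * w * ∑ t ∈ Finset.Icc 1 T, ∫ ω, Δ (X.I t ω) ∂μ := by rw [Finset.mul_sum]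
    _ ≤ _ := mul_le_mul_of_nonneg_left (by linarith) (by positivity)

end IsRun

/-! ### The two regret bounds -/

lemma kappa_eq (P : Params K) (zmax : ℝ) (q₁ : Fin K → ℝ) : kappa P zmax q₁ =
    zmax / P.β₁ + (P.β₁ * (-tsallis P.α q₁) + P.βbar * (-tsallis (1 - P.α) q₁)) := by
  unfold kappa; ring

lemma initial_nonneg {q₁ : Fin K → ℝ} (hq₁ : q₁ ∈ stdSimplex ℝ (Fin K)) :
    0 ≤ P.β₁ * (-tsallis P.α q₁) + P.βbar * (-tsallis (1 - P.α) q₁) := by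
  have h1 := tsallis_nonpos P.α_pos P.α_lt_one hq₁
  have h2 := tsallis_nonpos (a := 1 - P.α) (by linarith [P.α_lt_one]) (by linarith [P.α_pos]) hq₁
  have := mul_nonneg P.β₁_pos.le (neg_nonneg.2 h1)
  have := mul_nonneg P.βbar_nonneg (neg_nonneg.2 h2)
  linarith

/-- With a single action there is nothing to regret. -/
lemma regret_eq_zero_of_subsingleton [Subsingleton (Fin K)] (X : Play K Ω) (T : ℕ) :
    X.regret μ T = 0 := by
  have : ∀ i, X.regretAgainst μ T i = 0 := fun i => by
    simp [Play.regretAgainst, Subsingleton.elim _ i]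
  simp [Play.regret, this]

lemma sqrt_sum_z_le {X : Play K Ω} {zmax : ℝ} {ω : Ω}
    (hz : ∀ t, 1 ≤ t → X.z t ω ≤ zmax) {H : ℝ} (hH : 0 ≤ H) (T : ℕ) :
    √(H * ∑ t ∈ Finset.Icc 1 T, X.z t ω) ≤ √(H * zmax * T) := by
  refine Real.sqrt_le_sqrt ?_
  rw [mul_assoc]
  refine mul_le_mul_of_nonneg_left ?_ hH
  calc _ ≤ ∑ t ∈ Finset.Icc 1 T, zmax := Finset.sum_le_sum fun t ht =>
        hz t (Finset.mem_Icc.1 ht).1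
    _ = zmax * T := by simp [mul_comm]

namespace IsRun

lemma integrable_sqrt_sum_z [IsProbabilityMeasure μ] (hX : IsRun P X μ 𝓗) {zmax : ℝ}
    (hz : ∀ᵐ ω ∂μ, ∀ t, 1 ≤ t → X.z t ω ≤ zmax) {H : ℝ} (hH : 0 ≤ H) (T : ℕ) :
    Integrable (fun ω => √(H * ∑ t ∈ Finset.Icc 1 T, X.z t ω)) μ := by
  refine integrable_of_bound (c := √(H * zmax * T)) ?_ ?_
  · have : Measurable fun ω => ∑ t ∈ Finset.Icc 1 T, X.z t ω :=
      Finset.measurable_sum _ fun t ht => hX.measurable_z (Finset.mem_Icc.1 ht).1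
    fun_prop
  · filter_upwards [hz] with ω h
    rw [abs_of_nonneg (Real.sqrt_nonneg _)]
    exact sqrt_sum_z_le h hH T

/-- The adversarial bound. -/
lemma regret_le_sqrt [IsProbabilityMeasure μ] (hX : IsRun P X μ 𝓗) (hK : 2 ≤ K)
    {c₁ c₂ : ℝ} (hc₁ : 0 < c₁) (hc₂ : 0 < c₂) (hpen : X.PenaltyCondition μ P.α c₁)
    (hst : X.StabilityCondition μ 𝓗 P.α c₂) {zmax : ℝ} (hzm : 0 < zmax)
    (hz : ∀ᵐ ω ∂μ, ∀ t, 1 ≤ t → X.z t ω ≤ zmax) {q₁ : Fin K → ℝ}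
    (hq₁ : q₁ ∈ ftrlArgmin P.α P.β₁ P.βbar 0) (T : ℕ) :
    X.regret μ T ≤ (5 * (c₁ + c₂) + 1) *
      ∫ ω, (√(-tsallis P.α q₁ * ∑ t ∈ Finset.Icc 1 T, X.z t ω) + kappa P zmax q₁) ∂μ := by
  have : Nonempty (Fin K) := ⟨⟨0, by omega⟩⟩
  have hH : 0 ≤ -tsallis P.α q₁ := neg_nonneg.2 (tsallis_nonpos P.α_pos P.α_lt_one hq₁.1)
  have is := hX.integrable_sqrt_sum_z hz hH T
  refine ciSup_le fun i => (hX.regretAgainst_le hK hpen hst hz hq₁ T i).trans ?_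
  have h0 := initial_nonneg (P := P) hq₁.1
  have h1 : ∫ ω, ∑ t ∈ Finset.Icc 1 T, X.z t ω / X.β t ω ∂μ ≤
      ∫ ω, (5 * √(-tsallis P.α q₁ * ∑ t ∈ Finset.Icc 1 T, X.z t ω) + 2 * (zmax / P.β₁)) ∂μ := by
    refine integral_mono_ae (integrable_finsetSum _ fun t ht =>
      hX.integrable_z_div_β hz (Finset.mem_Icc.1 ht).1)
      ((is.const_mul 5).add (integrable_const _)) ?_
    filter_upwards [hz] with ω hω
    have := sum_div_le_sqrt (b := fun t => X.β t ω) (h := fun t => X.h P.α t ω)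
      (z := fun t => X.z t ω) T (hX.β_pos le_rfl ω) (fun t ht => hX.h_pos hK ht ω)
      (fun t ht => hX.h_le hq₁ ht ω) (fun t ht => hX.z_nonneg t ht ω) hω
      (fun t ht => hX.β_succ t ht ω)
    rwa [hX.β_one ω] at this
  have i5 : Integrable
      (fun ω => 5 * √(-tsallis P.α q₁ * ∑ t ∈ Finset.Icc 1 T, X.z t ω)) μ := is.const_mul 5
  rw [integral_add i5 (integrable_const _), integral_const_mul, integral_const,
    probReal_univ, one_smul] at h1
  rw [integral_add is (integrable_const _), integral_const, probReal_univ, one_smul, kappa_eq]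
  have hI : 0 ≤ ∫ ω, √(-tsallis P.α q₁ * ∑ t ∈ Finset.Icc 1 T, X.z t ω) ∂μ :=
    integral_nonneg fun ω => Real.sqrt_nonneg _
  have hc : 0 < c₁ + c₂ := by linarith
  have hzb : 0 ≤ zmax / P.β₁ := div_nonneg hzm.le P.β₁_pos.le
  have h2 := mul_le_mul_of_nonneg_left h1 hc.le
  have p1 := mul_nonneg hc.le hzb
  have p2 := mul_nonneg hc.le h0
  linarith

/-- The bound under a self-bounding constraint. -/
lemma regret_le_logPlus [IsProbabilityMeasure μ] (hX : IsRun P X μ 𝓗) (hK : 2 ≤ K)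
    {c₁ c₂ : ℝ} (hc₁ : 0 < c₁) (hc₂ : 0 < c₂) (hpen : X.PenaltyCondition μ P.α c₁)
    (hst : X.StabilityCondition μ 𝓗 P.α c₂) {zmax : ℝ} (hzm : 0 < zmax)
    (hz : ∀ᵐ ω ∂μ, ∀ t, 1 ≤ t → X.z t ω ≤ zmax) {q₁ : Fin K → ℝ}
    (hq₁ : q₁ ∈ ftrlArgmin P.α P.β₁ P.βbar 0) {T : ℕ} {Δ : Fin K → ℝ} {C w : ℝ}
    (hsb : X.SelfBounding μ Δ C T) (hw : 0 < w)
    (hhz : ∀ t, 1 ≤ t → ∀ᵐ ω ∂μ, X.h P.α t ω * X.z t ω ≤ w * dotProduct Δ (X.q t ω)) :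
    X.regret μ T ≤ (12 * (c₁ + c₂) + 8 * (c₁ + c₂) ^ 2 + 2) *
      (w * logPlus (-tsallis P.α q₁ * (zmax * T) / (w ^ 2 + C * w)) +
      √(C * w * logPlus (-tsallis P.α q₁ * (zmax * T) / (w ^ 2 + C * w)))
        + kappa P zmax q₁) := by
  have : Nonempty (Fin K) := ⟨⟨0, by omega⟩⟩
  have mem : ∀ {t}, t ∈ Finset.Icc 1 T → 1 ≤ t := fun h => (Finset.mem_Icc.1 h).1
  have hH : 0 < -tsallis P.α q₁ := neg_pos.2 (tsallis_neg hK P.α_pos P.α_lt_one hq₁.1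
    (pos_of_mem_ftrlArgmin P.α_pos P.α_lt_one P.β₁_pos P.βbar_nonneg hq₁))
  have hc : 0 < c₁ + c₂ := by linarith
  rw [kappa_eq]
  refine self_bounding_tuning hc hH hw hsb.2.1 (div_nonneg hzm.le P.β₁_pos.le)
    (initial_nonneg hq₁.1) fun θ₁ θ₂ η hθ hθ' hη => ?_
  refine ciSup_le fun i => (hX.regretAgainst_le hK hpen hst hz hq₁ T i).trans ?_
  refine add_le_add_left (mul_le_mul_of_nonneg_left ?_ hc.le) _
  have iG : Integrable (fun ω => ∑ t ∈ Finset.Icc 1 T, X.h P.α t ω * X.z t ω) μ :=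
    integrable_finsetSum _ fun t ht => hX.integrable_h_mul_z hz hq₁ (mem ht)
  set D := 2 * (zmax / P.β₁) + 2 * (-tsallis P.α q₁ * θ₁) + zmax * T / θ₂
    + 1 / η * Real.log (2 * θ₂ / θ₁) with hD
  have h1 : ∫ ω, ∑ t ∈ Finset.Icc 1 T, X.z t ω / X.β t ω ∂μ ≤
      ∫ ω, (D + η / 2 * ∑ t ∈ Finset.Icc 1 T, X.h P.α t ω * X.z t ω) ∂μ := by
    refine integral_mono_ae (integrable_finsetSum _ fun t ht => hX.integrable_z_div_β hz (mem ht))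
      ((integrable_const D).add (iG.const_mul _)) ?_
    filter_upwards [hz] with ω hω
    have h := sum_div_le (b := fun t => X.β t ω) (h := fun t => X.h P.α t ω)
      (z := fun t => X.z t ω) T (hX.β_pos le_rfl ω) (fun t ht => hX.h_pos hK ht ω)
      (fun t ht => hX.h_le hq₁ ht ω) (fun t ht => hX.z_nonneg t ht ω) hω
      (fun t ht => hX.β_succ t ht ω) hθ hθ' hη
    rw [hX.β_one ω] at h
    have hZ : ∑ t ∈ Finset.Icc 1 T, X.z t ω ≤ zmax * T :=
      calc _ ≤ ∑ t ∈ Finset.Icc 1 T, zmax := Finset.sum_le_sum fun t ht => hω t (mem ht)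
        _ = zmax * T := by simp [mul_comm]
    have := div_le_div_of_nonneg_right hZ (hθ.trans_le hθ').le
    simp only [hD]
    linarith
  rw [integral_add (integrable_const D) (iG.const_mul _), integral_const_mul, integral_const,
    probReal_univ, one_smul] at h1
  have h2 := mul_le_mul_of_nonneg_left (hX.integral_sum_h_mul_z_le hz hq₁ hsb hw hhz)
    (half_pos hη).le
  linarith

end IsRun
end SPM
end

theorem mainTheorem5 (c₁ c₂ : ℝ) (hc₁ : 0 < c₁) (hc₂ : 0 < c₂) :
    ∃ M : ℝ, 0 < M ∧
      ∀ (K : ℕ) (Ω : Type*) (mΩ : MeasurableSpace Ω) (μ : MeasureTheory.Measure Ω)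
        (_ : MeasureTheory.IsProbabilityMeasure μ) (𝓗 : MeasureTheory.Filtration ℕ mΩ)
        (P : SPM.Params K) (X : SPM.Play K Ω) (_ : SPM.IsRun P X μ 𝓗)
        (_ : X.PenaltyCondition μ P.α c₁) (_ : X.StabilityCondition μ 𝓗 P.α c₂)
        (zmax : ℝ) (_ : 0 < zmax) (_ : ∀ᵐ ω ∂μ, ∀ t, 1 ≤ t → X.z t ω ≤ zmax)
        (q₁ : Fin K → ℝ) (_ : q₁ ∈ SPM.ftrlArgmin P.α P.β₁ P.βbar 0)
        (h₁ κ : ℝ) (_ : h₁ = -SPM.tsallis P.α q₁) (_ : κ = SPM.kappa P zmax q₁) (T : ℕ),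
        (X.regret μ T ≤ M * ∫ ω, (√(h₁ * ∑ t ∈ Finset.Icc 1 T, X.z t ω) + κ) ∂μ ∧
          (∫ ω, (√(h₁ * ∑ t ∈ Finset.Icc 1 T, X.z t ω) + κ) ∂μ) ≤ √(h₁ * zmax * T) + κ) ∧
        ∀ (Δ : Fin K → ℝ) (C w : ℝ), X.SelfBounding μ Δ C T → 0 < w →
          (∀ t, 1 ≤ t → ∀ᵐ ω ∂μ, X.h P.α t ω * X.z t ω ≤ w * dotProduct Δ (X.q t ω)) →
          X.regret μ T ≤
            M * (w * SPM.logPlus (h₁ * zmax * T / (w ^ 2 + C * w)) +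
              √(C * w * SPM.logPlus (h₁ * zmax * T / (w ^ 2 + C * w))) + κ) := by
  have hc : 0 < c₁ + c₂ := by linarith
  refine ⟨12 * (c₁ + c₂) + 8 * (c₁ + c₂) ^ 2 + 2, by positivity, ?_⟩
  rintro K Ω mΩ μ hμ 𝓗 P X hX hpen hst zmax hzm hz q₁ hq₁ h₁ κ rfl rfl T
  have hH : 0 ≤ -SPM.tsallis P.α q₁ :=
    neg_nonneg.2 (SPM.tsallis_nonpos P.α_pos P.α_lt_one hq₁.1)
  have hκ : 0 ≤ SPM.kappa P zmax q₁ := by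
    rw [SPM.kappa_eq]
    exact add_nonneg (div_nonneg hzm.le P.β₁_pos.le) (SPM.initial_nonneg hq₁.1)
  have hint : 0 ≤ ∫ ω, (√(-SPM.tsallis P.α q₁ * ∑ t ∈ Finset.Icc 1 T, X.z t ω)
      + SPM.kappa P zmax q₁) ∂μ :=
    integral_nonneg fun ω => add_nonneg (Real.sqrt_nonneg _) hκ
  have hsecond : ∫ ω, (√(-SPM.tsallis P.α q₁ * ∑ t ∈ Finset.Icc 1 T, X.z t ω)
      + SPM.kappa P zmax q₁) ∂μ
      ≤ √(-SPM.tsallis P.α q₁ * zmax * T) + SPM.kappa P zmax q₁ := by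
    have is := hX.integrable_sqrt_sum_z hz hH T
    refine (integral_mono_ae (is.add (integrable_const _)) (integrable_const
      (√(-SPM.tsallis P.α q₁ * zmax * T) + SPM.kappa P zmax q₁)) ?_).trans (by simp)
    filter_upwards [hz] with ω hω
    exact add_le_add_left (SPM.sqrt_sum_z_le hω hH T) _
  refine ⟨⟨?_, hsecond⟩, fun Δ C w hsb hw hhz => ?_⟩
  · rcases Nat.lt_or_ge K 2 with hK | hK
    · have : Subsingleton (Fin K) := Fin.subsingleton_iff_le_one.2 (by omega)
      rw [SPM.regret_eq_zero_of_subsingleton]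
      positivity
    · refine (hX.regret_le_sqrt hK hc₁ hc₂ hpen hst hzm hz hq₁ T).trans
        (mul_le_mul_of_nonneg_right ?_ hint)
      nlinarith
  · rcases Nat.lt_or_ge K 2 with hK | hK
    · have : Subsingleton (Fin K) := Fin.subsingleton_iff_le_one.2 (by omega)
      rw [SPM.regret_eq_zero_of_subsingleton]
      have : 0 ≤ SPM.logPlus (-SPM.tsallis P.α q₁ * zmax * T / (w ^ 2 + C * w)) :=
        zero_le_one.trans (le_max_left _ _)
      positivity
    · have := hX.regret_le_logPlus hK hc₁ hc₂ hpen hst hzm hz hq₁ hsb hw hhz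
      rwa [← mul_assoc (-SPM.tsallis P.α q₁)] at this
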